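/- Let $m\ge 2$, let $\mathbb F\subseteq\mathbb C$ be a subfield invariant under complex conjugation, and let $\mathbf H$ be the canonical Haar matrix of rank $m$: its row $0$ is $(1,\dots,1)$, and for $1\le i\le m-1$, with $s=m-i$, its row $i$ is $\sqrt{m/(s^2+s)}\,(0,\dots,0,-s,1,\dots,1)$ with $i-1$ zeros and $s$ ones. Assume that $\mathbf H$ has entries in $\mathbb F$ (for example $\mathbb F=\mathbb R$ or $\mathbb C$, or $m=2$ and any $\mathbb F$). For an $m\times m$ matrix $A(z)=\sum_k A_kz^{-k}$ over $\mathbb F[z,z^{-1}]$ put $\tilde A(z)=\sum_k A_k^*z^{k}$. The genus of $A\neq 0$ is $k_1-k_0+1$, where $k_0,k_1$ are the smallest and the largest $k$ with $A_k\ne0$; $A(z)$ is called an $m\times mg$ matrix if its nonzero coefficients $A_k$ fit into $g$ consecutive indices (i.e. its genus is at most $g$), and is then identified with the block matrix $(A_{k_0},\dots,A_{k_0+g-1})$. A pair $(L,R)$ is a biorthogonal wavelet pair of rank $m$ if $L(z)\tilde R(z)=mI_m$ and in both block matrices row $0$ has sum $m$ and every other row has sum $0$. Then a pair $(L,R)$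 of $m\times mg$ matrices over $\mathbb F[z,z^{-1}]$ is a biorthogonal wavelet pair of rank $m$ if and only if there are $k_0\in\mathbb Z$, $d\ge0$, $r\ge1$, primitive paraunitary matrices $V_i(z)=I_m-v_iv_i^*+v_iv_i^*z^{-1}$ ($1\le i\le d$) with coefficients in $\mathbb F$, where the $v_i\in\mathbb C^m$ are unit column vectors, matrices $N_i\in gl(m,\mathbb F)$ with $N_i^2=0$ and integers $k_i\ge1$ ($1\le i\le r$), and $G\in GL(m-1,\mathbb F)$, such that, with $L_{N_i}(z)=I_m-N_i+N_iz^{-k_i}$ and $R_{N_i}(z)=I_m+N_i^*-N_i^*z^{k_i}$, $$L(z)=z^{-k_0}V_1(z)\cdots V_d(z)\,L_{N_r}(z)\cdots L_{N_1}(z)\begin{pmatrix}1&0\\0&G\end{pmatrix}\mathbf H,$$ $$R(z)=z^{-k_0}V_1(z)\cdots V_d(z)\,R_{N_r}(z)\cdots R_{N_1}(z)\begin{pmatrix}1&0\\0&(G^{-1})^*\end{pmatrix}\mathbf H,$$ where $\det L(z)=cz^{-b}$ with $c\neq0$, $d=b-mk_0$, and the genus of $L_{N_r}(z)\cdots L_{N_1}(z)$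 is at most $g$. If moreover every nonzero vector of $\mathbb F^m$ has a scalar multiple by an element of $\mathbb F$ that is a unit vector (for example if $\mathbb F=\mathbb R$ or $\mathbb C$), then the same equivalence holds with all $v_i\in\mathbb F^m$. -/

import Mathlib

open scoped LaurentPolynomial Matrix

noncomputable section

namespace BiorthWavelet

/-- `m × m` matrices over the ring of complex Laurent polynomials in `z`; the variable `z ^ n`
is `LaurentPolynomial.T n`. -/
abbrev LMat (m : ℕ) : Type := Matrix (Fin m) (Fin m) ℂ[T;T⁻¹]

/-- A matrix over `F[z, z⁻¹]`, viewed over `ℂ[z, z⁻¹]`. -/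
def toComplex (F : Subfield ℂ) {m : ℕ} (A : Matrix (Fin m) (Fin m) F[T;T⁻¹]) : LMat m :=
  A.map (AddMonoidAlgebra.mapRingHom ℤ F.subtype)

/-- A constant matrix, viewed as a matrix of Laurent polynomials. -/
def const {m : ℕ} (A : Matrix (Fin m) (Fin m) ℂ) : LMat m := A.map LaurentPolynomial.C

/-- The scalar Laurent polynomial `z ^ n`. -/
def zPow (n : ℤ) : ℂ[T;T⁻¹] := LaurentPolynomial.T n

/-- The block `A_k` in the expansion `A(z) = ∑ A_k z^{-k}`. -/
def block {m : ℕ} (A : LMat m) (k : ℤ) : Matrix (Fin m) (Fin m) ℂ :=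
  Matrix.of fun i j => (A i j).coeff (-k)

/-- The finite set of the indices `k` with `A_k ≠ 0`. -/
def blockSupport {m : ℕ} (A : LMat m) : Finset ℤ :=
  Finset.univ.biUnion fun i : Fin m => Finset.univ.biUnion fun j : Fin m =>
    (A i j).coeff.support.image fun n => -n

theorem mem_blockSupport {m : ℕ} (A : LMat m) (k : ℤ) :
    k ∈ blockSupport A ↔ block A k ≠ 0 := by
  have h : block A k ≠ 0 ↔ ∃ i j, (A i j).coeff (-k) ≠ 0 := by
    constructor
    · intro h
      by_contra! h'
      exact h (by ext i j; simpa [block] using h' i j)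
    · rintro ⟨i, j, hij⟩ h0
      exact hij (by simpa [block] using congrFun (congrFun h0 i) j)
  rw [h]
  simp [blockSupport, neg_eq_iff_eq_neg]

/-- The genus `k₁ - k₀ + 1`, where `k₀` and `k₁` are the smallest and the largest index of a
nonzero block; the zero matrix gets genus `0`. -/
def genus {m : ℕ} (A : LMat m) : ℕ :=
  if h : (blockSupport A).Nonempty then
    ((blockSupport A).max' h - (blockSupport A).min' h + 1).toNat
  else 0

/-- `A(z)` is an `m × mg` matrix: its nonzero blocks fit into `g` consecutive blocks
(blocks that are zero are allowed at the ends). -/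
def HasSize {m : ℕ} (A : LMat m) (g : ℕ) : Prop := genus A ≤ g

/-- The adjoint `Ã(z) = ∑ A_k^* z^k`. -/
def adj {m : ℕ} (A : LMat m) : LMat m :=
  Matrix.of fun i j =>
    LaurentPolynomial.invert (AddMonoidAlgebra.mapRingHom ℤ (starRingEnd ℂ) (A j i))

/-- The sum of the `i`-th row of the block matrix `(A_{k₀}, …, A_{k₁})`. -/
def rowSum {m : ℕ} (A : LMat m) (i : Fin m) : ℂ :=
  ∑ k ∈ blockSupport A, ∑ j, block A k i j

/-- Biorthogonal wavelet matrix pairs of rank `m`. -/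
structure IsBiorthogonalWaveletPair {m : ℕ} (L R : LMat m) : Prop where
  quadratic : L * adj R = (m : ℂ[T;T⁻¹]) • (1 : LMat m)
  linear_left : ∀ i : Fin m, rowSum L i = if (i : ℕ) = 0 then (m : ℂ) else 0
  linear_right : ∀ i : Fin m, rowSum R i = if (i : ℕ) = 0 then (m : ℂ) else 0

/-- `v` is a unit column vector: `v^* v = 1`. -/
def IsUnitVector {m : ℕ} (v : Fin m → ℂ) : Prop := star v ⬝ᵥ v = 1

/-- `I - v v^* + v v^* z⁻¹`; a primitive paraunitary matrix if `v` is a unit vector. -/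
def primitiveParaunitary {m : ℕ} (v : Fin m → ℂ) : LMat m :=
  1 - const (Matrix.vecMulVec v (star v)) + zPow (-1) • const (Matrix.vecMulVec v (star v))

/-- `L_N(z) = I - N + N z^{-k}`. -/
def leftFactor {m : ℕ} (N : Matrix (Fin m) (Fin m) ℂ) (k : ℕ) : LMat m :=
  1 - const N + zPow (-(k : ℤ)) • const N

/-- `R_N(z) = I + N^* - N^* z^k`. -/
def rightFactor {m : ℕ} (N : Matrix (Fin m) (Fin m) ℂ) (k : ℕ) : LMat m :=
  1 + const Nᴴ - zPow (k : ℤ) • const Nᴴ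

/-- The block diagonal matrix `diag(1, G)`. -/
def diagOne {m : ℕ} (G : Matrix (Fin (m - 1)) (Fin (m - 1)) ℂ) : Matrix (Fin m) (Fin m) ℂ :=
  Matrix.of fun i j =>
    if hi : (i : ℕ) = 0 then (if (j : ℕ) = 0 then 1 else 0)
    else if hj : (j : ℕ) = 0 then 0
    else G ⟨(i : ℕ) - 1, by omega⟩ ⟨(j : ℕ) - 1, by omega⟩

/-- The canonical Haar matrix of rank `m`. Its row `0` is `(1, …, 1)`. With `s = m - i`, its row
`i ≥ 1` is `√(m / (s² + s)) · (0, …, 0, -s, 1, …, 1)`, with `i - 1` zeros and `s` ones. -/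
def canonicalHaar (m : ℕ) : Matrix (Fin m) (Fin m) ℂ :=
  Matrix.of fun i j =>
    if (i : ℕ) = 0 then 1
    else
      let s : ℝ := (m : ℝ) - (i : ℕ)
      if (j : ℕ) + 1 < (i : ℕ) then 0
      else if (j : ℕ) + 1 = (i : ℕ) then ((-s * √((m : ℝ) / (s ^ 2 + s)) : ℝ) : ℂ)
      else ((√((m : ℝ) / (s ^ 2 + s)) : ℝ) : ℂ)

/-- `b` is the exponent of `det A(z)`: `det A(z) = c z^{-b}` with `c ≠ 0`. -/
def IsDetExponent {m : ℕ} (A : LMat m) (b : ℤ) : Prop :=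
  ∃ c : ℂ, c ≠ 0 ∧ A.det = LaurentPolynomial.C c * zPow (-b)

/-- The factorization of a pair `(L, R)`. All factors have coefficients in `F`, and the unit
vectors that define the primitive paraunitary factors have their coordinates in `K`. -/
def HasFactorization (F K : Subfield ℂ) {m : ℕ} (g : ℕ) (L R : LMat m) : Prop :=
  ∃ (k₀ b : ℤ) (d r : ℕ) (v : Fin d → Fin m → ℂ) (N : Fin r → Matrix (Fin m) (Fin m) F)
    (k : Fin r → ℕ) (G : Matrix.GeneralLinearGroup (Fin (m - 1)) F),
    IsDetExponent L b ∧ (d : ℤ) = b - m * k₀ ∧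
    (∀ s, IsUnitVector (v s)) ∧
    (∀ s i, v s i ∈ K) ∧
    (∀ s i j, Matrix.vecMulVec (v s) (star (v s)) i j ∈ F) ∧
    0 < r ∧ (∀ i, N i ^ 2 = 0) ∧ (∀ i, 0 < k i) ∧
    genus (List.ofFn fun i => leftFactor ((N i).map F.subtype) (k i)).reverse.prod ≤ g ∧
    L = zPow (-k₀) •
      ((List.ofFn fun s => primitiveParaunitary (v s)).prod *
        (List.ofFn fun i => leftFactor ((N i).map F.subtype) (k i)).reverse.prod *
        const (diagOne ((G : Matrix (Fin (m - 1)) (Fin (m - 1)) F).map F.subtype)) *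
        const (canonicalHaar m)) ∧
    R = zPow (-k₀) •
      ((List.ofFn fun s => primitiveParaunitary (v s)).prod *
        (List.ofFn fun i => rightFactor ((N i).map F.subtype) (k i)).reverse.prod *
        const (diagOne
          (((G⁻¹ : Matrix.GeneralLinearGroup (Fin (m - 1)) F) :
            Matrix (Fin (m - 1)) (Fin (m - 1)) F).map F.subtype)ᴴ) *
        const (canonicalHaar m))

end BiorthWavelet

end

open scoped LaurentPolynomial Matrix

noncomputable section

namespace BiorthWavelet

/-! Up to a power of `z`, the matrix `L` is a polynomial matrix `P` in `X = z⁻¹`. The identity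
`L R̃ = m I` makes `det P` a unit of the Laurent polynomials, hence a monomial `c X ^ d`.

If `d > 0`, then `P(0)` is singular; a row vector `w ≠ 0` with `w P(0) = 0` and a column vector `a`
with `w a = 1` split off the factor `I - a w + a w X` on the left without raising the degree of `P`,
while `d` drops by one. For `a` proportional to `w^*`, this factor is primitive paraunitary. When
`d = 0`, the leading coefficients of the rows are linearly dependent as long as `P` is not constant,
so elementary row operations lower the row degrees until a constant matrix is left. Those row
operations are products of factors `I + N X ^ k` with `N² = 0`, which differ from the factors `L_N`
by invertible constant matrices; these can be moved to the right, as conjugation preserves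
`N² = 0`.

All the factors are `I` at `z = 1`, so the constant matrix left over is `L(1)`. The linear
conditions and `L(1) R(1)^* = m I` force it to be `diag(1, G) H`. Finally `L R̃ = m I` determines
`R` from `L`, and `R_N` is the matrix with `L_N R̃_N = I`. -/

section PolynomialMatrix

open Polynomial

section ShiftFactor

variable {R n : Type*} [CommRing R] [Fintype n] [DecidableEq n]

/-- The polynomial matrix `1 - N + N X ^ k`, the common shape of the factors `L_N` and of the
primitive paraunitary factors in the variable `X = z⁻¹`. -/
def shiftFactor (N : Matrix n n R) (k : ℕ) : Matrix n n R[X] :=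
  1 - C.mapMatrix N + (X : R[X]) ^ k • C.mapMatrix N

/-- Evaluation of a polynomial matrix at `X = 1`. -/
def evalOne : Matrix n n R[X] →+* Matrix n n R :=
  (evalRingHom 1).mapMatrix

theorem evalOne_mapMatrix_C (A : Matrix n n R) : evalOne (C.mapMatrix A) = A := by
  ext i j
  simp [evalOne]

theorem evalOne_shiftFactor (N : Matrix n n R) (k : ℕ) : evalOne (shiftFactor N k) = 1 := by
  have hX : evalOne ((X : R[X]) ^ k • C.mapMatrix N) = N := by
    ext i j
    simp [evalOne]
  rw [shiftFactor, map_add, map_sub, map_one, hX, evalOne_mapMatrix_C, sub_add_cancel]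

/-- The monoid generated by the factors `1 - N + N X ^ k` with `N ^ 2 = 0` and `k ≥ 1`. -/
def nilShiftMonoid (R n : Type*) [CommRing R] [Fintype n] [DecidableEq n] :
    Submonoid (Matrix n n R[X]) :=
  Submonoid.closure {Q | ∃ (N : Matrix n n R) (k : ℕ), N ^ 2 = 0 ∧ 0 < k ∧ shiftFactor N k = Q}

theorem shiftFactor_mem_nilShiftMonoid {N : Matrix n n R} (hN : N ^ 2 = 0) {k : ℕ} (hk : 0 < k) :
    shiftFactor N k ∈ nilShiftMonoid R n :=
  Submonoid.subset_closure ⟨N, k, hN, hk, rfl⟩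

theorem evalOne_of_mem_nilShiftMonoid {B : Matrix n n R[X]} (hB : B ∈ nilShiftMonoid R n) :
    evalOne B = 1 := by
  induction hB using Submonoid.closure_induction with
  | mem Q hQ =>
    obtain ⟨N, k, -, -, rfl⟩ := hQ
    exact evalOne_shiftFactor N k
  | one => exact map_one _
  | mul A B _ _ hA hB => rw [map_mul, hA, hB, one_mul]

theorem mapMatrix_C_mul_shiftFactor (U : (Matrix n n R)ˣ) (N : Matrix n n R) (k : ℕ) :
    C.mapMatrix ↑U * shiftFactor N k =
      shiftFactor (U.val * N * U⁻¹.val) k * C.mapMatrix (U : Matrix n n R) := by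
  have h : C.mapMatrix ↑U * C.mapMatrix N =
      C.mapMatrix (U.val * N * U⁻¹.val) * C.mapMatrix (U : Matrix n n R) := by
    rw [← map_mul, ← map_mul, mul_assoc, Units.inv_mul, mul_one]
  simp only [shiftFactor, mul_add, mul_sub, add_mul, sub_mul, Matrix.mul_smul, Matrix.smul_mul,
    h, mul_one, one_mul]

theorem exists_mapMatrix_C_mul_eq_of_mem_nilShiftMonoid (U : (Matrix n n R)ˣ)
    {B : Matrix n n R[X]} (hB : B ∈ nilShiftMonoid R n) :
    ∃ B' ∈ nilShiftMonoid R n,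
      C.mapMatrix ↑U * B = B' * C.mapMatrix (U : Matrix n n R) := by
  induction hB using Submonoid.closure_induction with
  | mem Q hQ =>
    obtain ⟨N, k, hN, hk, rfl⟩ := hQ
    refine ⟨_, shiftFactor_mem_nilShiftMonoid ?_ hk, mapMatrix_C_mul_shiftFactor U N k⟩
    rw [Units.conj_pow, hN, mul_zero, zero_mul]
  | one => exact ⟨1, one_mem _, by rw [mul_one, one_mul]⟩
  | mul A B _ _ hA hB =>
    obtain ⟨A', hA', hUA⟩ := hA
    obtain ⟨B', hB', hUB⟩ := hB
    exact ⟨A' * B', mul_mem hA' hB', by rw [← mul_assoc, hUA, mul_assoc, hUB, mul_assoc]⟩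

/-- The products `B U` of an element `B` of `nilShiftMonoid` and an invertible constant
matrix `U`. -/
def nilShiftUnitMonoid (R n : Type*) [CommRing R] [Fintype n] [DecidableEq n] :
    Submonoid (Matrix n n R[X]) where
  carrier := {Q | ∃ B ∈ nilShiftMonoid R n, ∃ U : (Matrix n n R)ˣ, Q = B * C.mapMatrix ↑U}
  one_mem' := ⟨1, one_mem _, 1, by rw [Units.val_one, map_one, one_mul]⟩
  mul_mem' := by
    rintro _ _ ⟨A, hA, U, rfl⟩ ⟨B, hB, V, rfl⟩
    obtain ⟨B', hB', hUB⟩ := exists_mapMatrix_C_mul_eq_of_mem_nilShiftMonoid U hB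
    exact ⟨A * B', mul_mem hA hB', U * V, by
      rw [mul_assoc, ← mul_assoc _ B, hUB, Units.val_mul, map_mul, mul_assoc, mul_assoc]⟩

theorem mapMatrix_C_mem_nilShiftUnitMonoid {U : Matrix n n R} (hU : IsUnit U) :
    C.mapMatrix U ∈ nilShiftUnitMonoid R n :=
  ⟨1, one_mem _, hU.unit, by rw [one_mul, IsUnit.unit_spec]⟩

theorem mul_mapMatrix_C_evalOne_mem_nilShiftMonoid {Q : Matrix n n R[X]}
    (hQ : Q ∈ nilShiftUnitMonoid R n) :
    Q * C.mapMatrix (evalOne Q)⁻¹ ∈ nilShiftMonoid R n := by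
  obtain ⟨B, hB, U, rfl⟩ := hQ
  rwa [map_mul, evalOne_of_mem_nilShiftMonoid hB, one_mul, evalOne_mapMatrix_C,
    ← Matrix.coe_units_inv, mul_assoc, ← map_mul, Units.mul_inv, map_one, mul_one]

theorem one_add_X_pow_smul_mem_nilShiftUnitMonoid {N : Matrix n n R} (hN : N ^ 2 = 0) (k : ℕ) :
    1 + (X : R[X]) ^ k • C.mapMatrix N ∈ nilShiftUnitMonoid R n := by
  have hunit : IsUnit (1 + N) := (show IsNilpotent N from ⟨2, hN⟩).isUnit_one_add
  rcases Nat.eq_zero_or_pos k with rfl | hk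
  · rw [pow_zero, one_smul, ← map_one C.mapMatrix, ← map_add]
    exact mapMatrix_C_mem_nilShiftUnitMonoid hunit
  · refine ⟨_, shiftFactor_mem_nilShiftMonoid hN hk, hunit.unit, ?_⟩
    have hNN : C.mapMatrix N * C.mapMatrix N = 0 := by rw [← map_mul, ← sq, hN, map_zero]
    rw [IsUnit.unit_spec, map_add, map_one, shiftFactor]
    simp only [mul_add, add_mul, sub_mul, Matrix.smul_mul, hNN, mul_one, one_mul, smul_zero]
    abel

end ShiftFactor

section RowOperation

variable {R S n : Type*} [CommRing R] [CommRing S] [Fintype n] [DecidableEq n]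

/-- The elementary matrix that adds the linear combination `u ᵥ* Q` of the rows of a matrix `Q`
to its row `i`. -/
def rowOperation (i : n) (u : n → S) : Matrix n n S :=
  1 + Matrix.vecMulVec (Pi.single i 1) u

theorem rowOperation_add {i : n} {u v : n → S} (hu : u i = 0) :
    rowOperation i (u + v) = rowOperation i u * rowOperation i v := by
  have h : Matrix.vecMulVec (Pi.single i 1) u * Matrix.vecMulVec (Pi.single i 1) v = 0 := by
    rw [Matrix.vecMulVec_mul_vecMulVec, dotProduct_single_one, hu, zero_smul, Matrix.vecMulVec_zero]
  simp only [rowOperation, Matrix.vecMulVec_add, add_mul, mul_add, one_mul, mul_one, h]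
  abel

omit [Fintype n] in
theorem rowOperation_zero (i : n) : rowOperation i (0 : n → S) = 1 := by
  rw [rowOperation, Matrix.vecMulVec_zero, add_zero]

theorem rowOperation_mul (i : n) (u : n → S) (Q : Matrix n n S) :
    rowOperation i u * Q = Q.updateRow i (Q i + u ᵥ* Q) := by
  rw [rowOperation, add_mul, one_mul, Matrix.vecMulVec_mul]
  ext l j
  by_cases hl : l = i
  · subst hl
    simp [Matrix.vecMulVec_apply]
  · simp [Matrix.vecMulVec_apply, hl]

theorem rowOperation_neg_mul_rowOperation {i : n} {u : n → S}
    (hu : u i = 0) : rowOperation i (-u) * rowOperation i u = 1 := by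
  rw [← rowOperation_add (by rw [Pi.neg_apply, hu, neg_zero]), neg_add_cancel, rowOperation_zero]

theorem isUnit_det_rowOperation {i : n} {u : n → S} (hu : u i = 0) :
    IsUnit (rowOperation i u).det :=
  Matrix.isUnit_det_of_left_inverse (rowOperation_neg_mul_rowOperation hu)

theorem rowOperation_single_mem_nilShiftUnitMonoid {i l : n} (hl : l ≠ i) (p : R[X]) :
    rowOperation i (Pi.single l p) ∈ nilShiftUnitMonoid R n := by
  have hi (p : R[X]) : (Pi.single l p : n → R[X]) i = 0 := by simp [hl.symm]
  induction p using Polynomial.induction_on' with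
  | add p q hp hq =>
    rw [Pi.single_add, rowOperation_add (hi p)]
    exact mul_mem hp hq
  | monomial k a =>
    have hN : (Matrix.single i l a) ^ 2 = 0 := by
      rw [sq, Matrix.single_mul_single_of_ne _ _ _ _ hl]
    convert one_add_X_pow_smul_mem_nilShiftUnitMonoid hN k using 1
    rw [rowOperation]
    congr 1
    ext1 s t
    rcases eq_or_ne s i with rfl | hs <;> rcases eq_or_ne t l with rfl | ht <;>
      simp [Matrix.vecMulVec_apply, X_pow_mul_C, C_mul_X_pow_eq_monomial, *, Ne.symm]

theorem rowOperation_mem_nilShiftUnitMonoid {i : n} {u : n → R[X]} (hu : u i = 0) :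
    rowOperation i u ∈ nilShiftUnitMonoid R n := by
  let S : AddSubmonoid (n → R[X]) :=
    { carrier := {v | v i = 0 ∧ rowOperation i v ∈ nilShiftUnitMonoid R n}
      zero_mem' := ⟨rfl, by rw [rowOperation_zero]; exact one_mem _⟩
      add_mem' := fun {v w} hv hw => ⟨by rw [Pi.add_apply, hv.1, hw.1, add_zero],
        by rw [rowOperation_add hv.1]; exact mul_mem hv.2 hw.2⟩ }
  suffices h : ∑ l, Pi.single l (u l) ∈ S by
    rw [Finset.univ_sum_single] at h
    exact h.2
  refine sum_mem fun l _ => ?_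
  by_cases hl : l = i
  · rw [hl, hu, Pi.single_zero]
    exact S.zero_mem
  · exact ⟨Pi.single_eq_of_ne (Ne.symm hl) _, rowOperation_single_mem_nilShiftUnitMonoid hl _⟩

end RowOperation

section RowReduction

theorem coeff_prod_sum_of_natDegree_le {R ι : Type*} [CommSemiring R] (s : Finset ι)
    {f : ι → R[X]} {d : ι → ℕ} (h : ∀ i ∈ s, (f i).natDegree ≤ d i) :
    (∏ i ∈ s, f i).coeff (∑ i ∈ s, d i) = ∏ i ∈ s, (f i).coeff (d i) := by
  classical
  induction s using Finset.induction_on with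
  | empty => simp
  | insert a s ha ih =>
    have hs : ∀ i ∈ s, (f i).natDegree ≤ d i := fun i hi => h i (Finset.mem_insert_of_mem hi)
    rw [Finset.prod_insert ha, Finset.sum_insert ha, Finset.prod_insert ha,
      coeff_mul_add_eq_of_natDegree_le (h a (Finset.mem_insert_self _ _))
        ((natDegree_prod_le _ _).trans (Finset.sum_le_sum hs)), ih hs]

variable {R n : Type*} [CommRing R] [Fintype n] [DecidableEq n]

/-- The constant matrix of the coefficients of `X ^ d i` in row `i`: the leading row coefficients
of a polynomial matrix whose row degrees are bounded by `d`. -/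
def rowCoeff (Q : Matrix n n R[X]) (d : n → ℕ) : Matrix n n R :=
  Matrix.of fun i j => (Q i j).coeff (d i)

theorem coeff_det_sum_of_natDegree_le {Q : Matrix n n R[X]} {d : n → ℕ}
    (h : ∀ i j, (Q i j).natDegree ≤ d i) :
    Q.det.coeff (∑ i, d i) = (rowCoeff Q d).det := by
  rw [← Matrix.det_transpose Q, ← Matrix.det_transpose (rowCoeff Q d), Matrix.det_apply,
    Matrix.det_apply, finsetSum_coeff]
  refine Finset.sum_congr rfl fun σ _ => ?_
  have hprod := coeff_prod_sum_of_natDegree_le Finset.univ fun i _ => h i (σ i)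
  simpa only [Units.smul_def, coeff_smul, Matrix.transpose_apply, rowCoeff, Matrix.of_apply]
    using congrArg (_ • ·) hprod

omit [DecidableEq n] in
theorem coeff_vecMul_eq_zero_of_vecMul_rowCoeff_eq_zero {Q : Matrix n n R[X]} {d : n → ℕ}
    (hQ : ∀ i j, (Q i j).natDegree ≤ d i) {w : n → R} (hw : w ᵥ* rowCoeff Q d = 0) {D e : ℕ}
    (hD : ∀ l, w l ≠ 0 → d l ≤ D) (he : D ≤ e) (j : n) :
    (((fun l => C (w l) * X ^ (D - d l)) ᵥ* Q) j).coeff e = 0 := by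
  have hterm (l : n) : (C (w l) * X ^ (D - d l) * Q l j).coeff e =
      w l * (Q l j).coeff (d l + (e - D)) := by
    by_cases hl : w l = 0
    · simp [hl]
    · have := hD l hl
      rw [mul_assoc, coeff_C_mul, show e = d l + (e - D) + (D - d l) by omega, coeff_X_pow_mul]
      congr 3
      omega
  simp only [Matrix.vecMul, dotProduct, finsetSum_coeff, hterm]
  rcases he.eq_or_lt with rfl | he
  · simpa [Matrix.vecMul, dotProduct, rowCoeff] using congrFun hw j
  · refine Finset.sum_eq_zero fun l _ => ?_
    rw [coeff_eq_zero_of_natDegree_lt ((hQ l j).trans_lt (by omega)), mul_zero]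

variable {K : Type*} [Field K]

theorem exists_vecMul_eq_zero_of_det_eq_zero {A : Matrix n n K} (hA : A.det = 0) (d : n → ℕ) :
    ∃ (w : n → K) (i : n), w ᵥ* A = 0 ∧ w i = 1 ∧ ∀ l, w l ≠ 0 → d l ≤ d i := by
  classical
  obtain ⟨w, hw0, hw⟩ := Matrix.exists_vecMul_eq_zero_iff.2 hA
  obtain ⟨i, hi, hmax⟩ := Finset.exists_max_image (Finset.univ.filter fun i => w i ≠ 0) d
    (by simpa [Finset.Nonempty] using Function.ne_iff.1 hw0)
  simp only [Finset.mem_filter, Finset.mem_univ, true_and] at hi hmax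
  exact ⟨(w i)⁻¹ • w, i, by rw [Matrix.smul_vecMul, hw, smul_zero], inv_mul_cancel₀ hi,
    fun l hl => hmax l (right_ne_zero_of_mul hl)⟩

theorem exists_rowOperation_natDegree_lt {Q : Matrix n n K[X]} {d : n → ℕ}
    (hQ : ∀ i j, (Q i j).natDegree ≤ d i) (hdet : IsUnit Q.det) (hd : 0 < ∑ i, d i) :
    ∃ (i : n) (u : n → K[X]), u i = 0 ∧ ∀ j, ((rowOperation i u * Q) i j).natDegree < d i := by
  have hlead : (rowCoeff Q d).det = 0 := by
    rw [← coeff_det_sum_of_natDegree_le hQ]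
    exact coeff_eq_zero_of_natDegree_lt ((natDegree_eq_zero_of_isUnit hdet).trans_lt hd)
  obtain ⟨w, i, hw, hwi, hmax⟩ := exists_vecMul_eq_zero_of_det_eq_zero hlead d
  let p : n → K[X] := fun l => C (w l) * X ^ (d i - d l)
  let u : n → K[X] := p - Pi.single i 1
  have hui : u i = 0 := by simp [u, p, hwi]
  have hrow : (rowOperation i u * Q) i = p ᵥ* Q := by
    rw [rowOperation_mul, Matrix.updateRow_self, Matrix.sub_vecMul, Matrix.single_one_vecMul]
    exact add_sub_cancel _ _
  have hcoeff (j : n) {e : ℕ} (he : d i ≤ e) : ((p ᵥ* Q) j).coeff e = 0 :=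
    coeff_vecMul_eq_zero_of_vecMul_rowCoeff_eq_zero hQ hw hmax he j
  have hdi : d i ≠ 0 := fun h0 => by
    have hzero : (rowOperation i u * Q).det = 0 :=
      Matrix.det_eq_zero_of_row_eq_zero i fun j => by
        rw [hrow]
        ext e
        exact hcoeff j (h0.trans_le e.zero_le)
    rw [Matrix.det_mul] at hzero
    exact ((isUnit_det_rowOperation hui).mul hdet).ne_zero hzero
  refine ⟨i, u, hui, fun j => ?_⟩
  rw [hrow]
  have := natDegree_le_iff_coeff_eq_zero.2 fun e (he : d i - 1 < e) => hcoeff j (by omega)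
  omega

theorem mem_nilShiftUnitMonoid_of_natDegree_le {Q : Matrix n n K[X]} {d : n → ℕ}
    (hQ : ∀ i j, (Q i j).natDegree ≤ d i) (hdet : IsUnit Q.det) :
    Q ∈ nilShiftUnitMonoid K n := by
  induction hs : ∑ i, d i using Nat.strong_induction_on generalizing d Q with
  | _ s ih =>
  subst hs
  rcases Nat.eq_zero_or_pos (∑ i, d i) with hd | hd
  · have hQC : Q = C.mapMatrix (rowCoeff Q d) := by
      have hd0 : ∀ i, d i = 0 := by simpa using hd
      ext1 i j
      simpa [rowCoeff, hd0] using eq_C_of_natDegree_le_zero ((hQ i j).trans (hd0 i).le)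
    rw [hQC]
    refine mapMatrix_C_mem_nilShiftUnitMonoid ((Matrix.isUnit_iff_isUnit_det _).2 ?_)
    rwa [hQC, ← RingHom.map_det, isUnit_C] at hdet
  · obtain ⟨i, u, hu, hlt⟩ := exists_rowOperation_natDegree_lt hQ hdet hd
    have hinv := rowOperation_neg_mul_rowOperation hu
    have hmem : rowOperation i u * Q ∈ nilShiftUnitMonoid K n := by
      refine ih (∑ l, Function.update d i (d i - 1) l) ?_ (d := Function.update d i (d i - 1))
        (fun l j => ?_) ?_ rfl
      · exact Finset.sum_lt_sum
          (fun l _ => update_le_self_iff.2 (Nat.sub_le _ _) l)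
          ⟨i, Finset.mem_univ i, by have := hlt i; rw [Function.update_self]; omega⟩
      · rcases eq_or_ne l i with rfl | hl
        · rw [Function.update_self]
          exact Nat.le_sub_one_of_lt (hlt j)
        · rw [rowOperation_mul, Matrix.updateRow_ne hl, Function.update_of_ne hl]
          exact hQ l j
      · rw [Matrix.det_mul]
        exact (isUnit_det_rowOperation hu).mul hdet
    rw [← one_mul Q, ← hinv, mul_assoc]
    exact mul_mem (rowOperation_mem_nilShiftUnitMonoid (by rw [Pi.neg_apply, hu, neg_zero])) hmem

theorem mem_nilShiftUnitMonoid_of_isUnit_det {Q : Matrix n n K[X]} (hdet : IsUnit Q.det) :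
    Q ∈ nilShiftUnitMonoid K n :=
  mem_nilShiftUnitMonoid_of_natDegree_le
    (fun i j => Finset.le_sup (f := fun j => (Q i j).natDegree) (Finset.mem_univ j)) hdet

end RowReduction

theorem natDegree_matrix_mul_le {R n : Type*} [CommSemiring R] [Fintype n] {A B : Matrix n n R[X]}
    {a b : ℕ} (hA : ∀ i j, (A i j).natDegree ≤ a) (hB : ∀ i j, (B i j).natDegree ≤ b) (i j : n) :
    ((A * B) i j).natDegree ≤ a + b :=
  natDegree_sum_le_of_forall_le _ _ fun l _ => natDegree_mul_le_of_le (hA i l) (hB l j)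

section NilpotentFactors

variable {R K n : Type*} [CommRing R] [Field K] [Fintype n] [DecidableEq n]

theorem shiftFactor_zero (k : ℕ) : shiftFactor (0 : Matrix n n R) k = 1 := by
  rw [shiftFactor, map_zero, smul_zero, sub_zero, add_zero]

theorem exists_eq_prod_shiftFactor_of_mem_nilShiftMonoid {B : Matrix n n R[X]}
    (hB : B ∈ nilShiftMonoid R n) :
    ∃ (r : ℕ) (N : Fin r → Matrix n n R) (k : Fin r → ℕ), 0 < r ∧ (∀ i, N i ^ 2 = 0) ∧
      (∀ i, 0 < k i) ∧ B = (List.ofFn fun i => shiftFactor (N i) (k i)).reverse.prod := by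
  obtain ⟨l, hl, rfl⟩ := Submonoid.exists_list_of_mem_closure hB
  -- The trivial factor `1 = shiftFactor 0 1` makes the number of factors positive.
  let l' := (1 :: l).reverse
  have hl' : ∀ Q ∈ l', ∃ (N : Matrix n n R) (k : ℕ), N ^ 2 = 0 ∧ 0 < k ∧ shiftFactor N k = Q := by
    intro Q hQ
    rcases List.mem_cons.1 (List.mem_reverse.1 hQ) with rfl | hQ
    · exact ⟨0, 1, zero_pow two_ne_zero, one_pos, shiftFactor_zero 1⟩
    · exact hl Q hQ
  choose N k hN hk hNk using fun i => hl' (l'.get i) (l'.get_mem i)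
  refine ⟨l'.length, N, k, by simp [l'], hN, hk, ?_⟩
  rw [funext hNk, List.ofFn_get, List.reverse_reverse, List.prod_cons, one_mul]

theorem exists_eq_prod_shiftFactor_mul_of_isUnit_det {Q : Matrix n n K[X]} (hQ : IsUnit Q.det) :
    ∃ (r : ℕ) (N : Fin r → Matrix n n K) (k : Fin r → ℕ), 0 < r ∧ (∀ i, N i ^ 2 = 0) ∧
      (∀ i, 0 < k i) ∧
      Q * C.mapMatrix (evalOne Q)⁻¹ = (List.ofFn fun i => shiftFactor (N i) (k i)).reverse.prod :=
  exists_eq_prod_shiftFactor_of_mem_nilShiftMonoid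
    (mul_mapMatrix_C_evalOne_mem_nilShiftMonoid (mem_nilShiftUnitMonoid_of_isUnit_det hQ))

end NilpotentFactors

section ProjectionFactors

variable {R K n : Type*} [CommRing R] [Field K] [Fintype n] [DecidableEq n]

theorem det_shiftFactor_vecMulVec {a w : n → R} (h : w ⬝ᵥ a = 1) :
    (shiftFactor (Matrix.vecMulVec a w) 1).det = X := by
  have hrank : shiftFactor (Matrix.vecMulVec a w) 1 =
      1 + Matrix.replicateCol Unit ((X - 1 : R[X]) • (C ∘ a)) *
        Matrix.replicateRow Unit (C ∘ w) := by
    rw [shiftFactor, sub_add_eq_add_sub, add_sub_assoc]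
    congr 1
    ext1 i j
    simp only [Matrix.vecMulVec_apply, Matrix.mul_apply, RingHom.mapMatrix_apply, Matrix.map_apply,
      Matrix.sub_apply, Matrix.smul_apply, Matrix.replicateCol_apply, Matrix.replicateRow_apply,
      Pi.smul_apply, Function.comp_apply, smul_eq_mul, map_mul, Finset.univ_unique,
      Finset.sum_singleton, pow_one]
    ring
  rw [hrank, Matrix.det_one_add_replicateCol_mul_replicateRow, dotProduct_smul,
    ← RingHom.map_dotProduct, h, map_one, smul_eq_mul, mul_one, add_sub_cancel]

theorem exists_eq_shiftFactor_mul {P : Matrix n n R[X]} {a w : n → R} (ha : w ⬝ᵥ a = 1)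
    (hw : w ᵥ* constantCoeff.mapMatrix P = 0) {N : ℕ} (hN : ∀ i j, (P i j).natDegree ≤ N) :
    ∃ Q : Matrix n n R[X], (∀ i j, (Q i j).natDegree ≤ N) ∧
      P = shiftFactor (Matrix.vecMulVec a w) 1 * Q := by
  set W : Matrix n n R[X] := C.mapMatrix (Matrix.vecMulVec a w) with hW
  let D : Matrix n n R[X] := P.map divX
  have hWW : W * W = W := by
    rw [hW, ← map_mul, Matrix.vecMulVec_mul_vecMulVec, ha, one_smul]
  have hWP : W * P = (X : R[X]) • (W * D) := by
    have hP : P = (X : R[X]) • D + C.mapMatrix (constantCoeff.mapMatrix P) := by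
      ext1 i j
      simp [D, X_mul_divX_add]
    have h0 : W * C.mapMatrix (constantCoeff.mapMatrix P) = 0 := by
      rw [hW, ← map_mul, Matrix.vecMulVec_mul, hw, Matrix.vecMulVec_zero, map_zero]
    conv_lhs => rw [hP]
    rw [mul_add, h0, add_zero, Matrix.mul_smul]
  refine ⟨P - W * P + W * D, fun i j => ?_, ?_⟩
  · have hWmul {B : Matrix n n R[X]} (hB : ∀ i j, (B i j).natDegree ≤ N) (i j : n) :
        ((W * B) i j).natDegree ≤ N :=
      (natDegree_matrix_mul_le (fun _ _ => (natDegree_C _).le) hB i j).trans (zero_add N).le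
    have hD (i j : n) : (D i j).natDegree ≤ N := natDegree_divX_le.trans (hN i j)
    exact natDegree_add_le_of_degree_le
      ((natDegree_sub_le _ _).trans (max_le (hN i j) (hWmul hN i j))) (hWmul hD i j)
  · have hWQ : W * (P - W * P + W * D) = W * D := by
      rw [mul_add, mul_sub, ← mul_assoc, ← mul_assoc, hWW, sub_self, zero_add]
    rw [shiftFactor, ← hW, pow_one, add_mul, sub_mul, one_mul, Matrix.smul_mul, hWQ, ← hWP]
    abel

theorem exists_eq_prod_shiftFactor_vecMulVec_mul {a : (n → K) → n → K}
    (ha : ∀ w ≠ 0, w ⬝ᵥ a w = 1) {c : K} (hc : c ≠ 0) {N d : ℕ} {P : Matrix n n K[X]}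
    (hdet : P.det = C c * X ^ d) (hN : ∀ i j, (P i j).natDegree ≤ N) :
    ∃ (w : Fin d → n → K) (Q : Matrix n n K[X]), (∀ s, w s ≠ 0) ∧ IsUnit Q.det ∧
      (∀ i j, (Q i j).natDegree ≤ N) ∧
      P = (List.ofFn fun s => shiftFactor (Matrix.vecMulVec (a (w s)) (w s)) 1).prod * Q := by
  induction d generalizing P with
  | zero =>
    refine ⟨Fin.elim0, P, fun s => s.elim0, ?_, hN, by rw [List.ofFn_zero, List.prod_nil, one_mul]⟩
    rw [hdet, pow_zero, mul_one]
    exact isUnit_C.2 hc.isUnit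
  | succ d ih =>
    have hdet0 : (constantCoeff.mapMatrix P).det = 0 := by
      rw [← RingHom.map_det, hdet, map_mul, map_pow, constantCoeff_apply, constantCoeff_apply,
        coeff_X_zero, zero_pow d.succ_ne_zero, mul_zero]
    obtain ⟨w, hw0, hw⟩ := Matrix.exists_vecMul_eq_zero_iff.2 hdet0
    obtain ⟨P', hN', hP'⟩ := exists_eq_shiftFactor_mul (ha w hw0) hw hN
    have hdet' : P'.det = C c * X ^ d := by
      rw [hP', Matrix.det_mul, det_shiftFactor_vecMulVec (ha w hw0), pow_succ',
        mul_left_comm] at hdet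
      exact mul_left_cancel₀ X_ne_zero hdet
    obtain ⟨v, Q, hv, hQ, hQN, hPQ⟩ := ih hdet' hN'
    refine ⟨Fin.cons w v, Q, Fin.cases hw0 hv, hQ, hQN, ?_⟩
    rw [hP', hPQ, List.ofFn_succ, List.prod_cons, mul_assoc]
    rfl

end ProjectionFactors

theorem evalOne_list_prod_shiftFactor {R n : Type*} [CommRing R] [Fintype n] [DecidableEq n]
    {r : ℕ} (N : Fin r → Matrix n n R) (k : Fin r → ℕ) :
    evalOne (List.ofFn fun i => shiftFactor (N i) (k i)).prod = 1 := by
  rw [map_list_prod, List.map_ofFn]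
  simp [Function.comp_def, evalOne_shiftFactor]

variable {K n : Type*} [Field K] [Fintype n] [DecidableEq n]

theorem exists_polynomial_factorization {a : (n → K) → n → K} (ha : ∀ w ≠ 0, w ⬝ᵥ a w = 1)
    {c : K} (hc : c ≠ 0) {n₀ d : ℕ} {P : Matrix n n K[X]} (hdet : P.det = C c * X ^ d)
    (hP : ∀ i j, (P i j).natDegree ≤ n₀) :
    ∃ (w : Fin d → n → K) (r : ℕ) (N : Fin r → Matrix n n K) (k : Fin r → ℕ),
      (∀ s, w s ≠ 0) ∧ 0 < r ∧ (∀ i, N i ^ 2 = 0) ∧ (∀ i, 0 < k i) ∧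
      (∀ i j, ((List.ofFn fun i => shiftFactor (N i) (k i)).reverse.prod i j).natDegree ≤ n₀) ∧
      P = (List.ofFn fun s => shiftFactor (Matrix.vecMulVec (a (w s)) (w s)) 1).prod *
        (List.ofFn fun i => shiftFactor (N i) (k i)).reverse.prod * C.mapMatrix (evalOne P) := by
  obtain ⟨w, Q, hw, hQ, hQn, hPQ⟩ := exists_eq_prod_shiftFactor_vecMulVec_mul ha hc hdet hP
  obtain ⟨r, N, k, hr, hN, hk, hNk⟩ := exists_eq_prod_shiftFactor_mul_of_isUnit_det hQ
  have hQ1 : evalOne Q = evalOne P := by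
    rw [hPQ, map_mul, evalOne_list_prod_shiftFactor, one_mul]
  have hunit : IsUnit (evalOne Q).det := by
    rw [evalOne, ← RingHom.map_det]
    exact hQ.map _
  refine ⟨w, r, N, k, hw, hr, hN, hk, fun i j => ?_, ?_⟩
  · rw [← hNk]
    exact natDegree_matrix_mul_le hQn (fun _ _ => (natDegree_C _).le) i j
  · rw [← hNk, ← hQ1, mul_assoc, mul_assoc, ← map_mul, Matrix.nonsing_inv_mul _ hunit, map_one,
      mul_one, ← hPQ]

end PolynomialMatrix

section Duality

variable {m : ℕ}

theorem const_mul (A B : Matrix (Fin m) (Fin m) ℂ) : const (A * B) = const A * const B :=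
  Matrix.map_mul

theorem const_one : const (1 : Matrix (Fin m) (Fin m) ℂ) = 1 :=
  Matrix.map_one _ (map_zero _) (map_one _)

theorem const_zero : const (0 : Matrix (Fin m) (Fin m) ℂ) = 0 :=
  Matrix.map_zero _ (map_zero _)

theorem const_natCast_smul_one :
    const ((m : ℂ) • (1 : Matrix (Fin m) (Fin m) ℂ)) = (m : ℂ[T;T⁻¹]) • (1 : LMat m) := by
  ext1 i j
  by_cases h : i = j <;> simp [const, h]

theorem zPow_mul_zPow_neg (n : ℤ) : zPow n * zPow (-n) = 1 := by
  rw [zPow, zPow, ← LaurentPolynomial.T_add, add_neg_cancel, LaurentPolynomial.T_zero]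

/-- The involution of `ℂ[z, z⁻¹]` that conjugates the coefficients and sends `z` to `z⁻¹`; it is
applied entrywise in the adjoint `Ã(z)`. -/
def conjInvert : ℂ[T;T⁻¹] →+* ℂ[T;T⁻¹] :=
  (LaurentPolynomial.invert (R := ℂ) : ℂ[T;T⁻¹] →+* ℂ[T;T⁻¹]).comp
    (AddMonoidAlgebra.mapRingHom ℤ (starRingEnd ℂ))

theorem coeff_conjInvert (f : ℂ[T;T⁻¹]) (n : ℤ) :
    (conjInvert f).coeff n = starRingEnd ℂ (f.coeff (-n)) := by
  simp [conjInvert]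

theorem conjInvert_conjInvert (f : ℂ[T;T⁻¹]) : conjInvert (conjInvert f) = f := by
  ext n
  simp [coeff_conjInvert]

theorem conjInvert_C (a : ℂ) :
    conjInvert (LaurentPolynomial.C a) = LaurentPolynomial.C (starRingEnd ℂ a) := by
  ext n
  simp [coeff_conjInvert, apply_ite (starRingEnd ℂ)]

theorem conjInvert_zPow (n : ℤ) : conjInvert (zPow n) = zPow (-n) := by
  ext k
  simp [coeff_conjInvert, zPow, apply_ite (starRingEnd ℂ), eq_neg_iff_add_eq_zero,
    neg_eq_iff_add_eq_zero]

theorem adj_eq_transpose (A : LMat m) : adj A = (conjInvert.mapMatrix A)ᵀ := rfl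

theorem adj_apply (A : LMat m) (i j : Fin m) : adj A i j = conjInvert (A j i) := rfl

theorem adj_mul (A B : LMat m) : adj (A * B) = adj B * adj A := by
  simp only [adj_eq_transpose, map_mul, Matrix.transpose_mul]

theorem adj_one : adj (1 : LMat m) = 1 := by
  simp only [adj_eq_transpose, map_one, Matrix.transpose_one]

theorem adj_add (A B : LMat m) : adj (A + B) = adj A + adj B := by
  simp only [adj_eq_transpose, map_add, Matrix.transpose_add]

theorem adj_sub (A B : LMat m) : adj (A - B) = adj A - adj B := by
  simp only [adj_eq_transpose, map_sub, Matrix.transpose_sub]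

theorem adj_zPow_smul (n : ℤ) (A : LMat m) : adj (zPow n • A) = zPow (-n) • adj A := by
  ext1 i j
  simp [adj_apply, conjInvert_zPow]

theorem adj_adj (A : LMat m) : adj (adj A) = A := by
  ext1 i j
  simp [adj_apply, conjInvert_conjInvert]

theorem adj_const (A : Matrix (Fin m) (Fin m) ℂ) : adj (const A) = const Aᴴ := by
  ext1 i j
  simp [adj_apply, const, conjInvert_C]

theorem zPow_smul_mul_adj_zPow_smul (n : ℤ) (A B : LMat m) :
    (zPow n • A) * adj (zPow n • B) = A * adj B := by
  rw [adj_zPow_smul, Matrix.smul_mul, Matrix.mul_smul, smul_smul, zPow_mul_zPow_neg, one_smul]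

/-- `B` is dual to `A` when `A(z) B̃(z) = I`; up to the scalar `m`, this is the quadratic condition
on a biorthogonal wavelet pair. -/
def IsDual (A B : LMat m) : Prop := A * adj B = 1

theorem isDual_one : IsDual (1 : LMat m) 1 := by
  rw [IsDual, adj_one, one_mul]

theorem IsDual.mul {A B A' B' : LMat m} (h : IsDual A B) (h' : IsDual A' B') :
    IsDual (A * A') (B * B') := by
  rw [IsDual, adj_mul, mul_assoc, ← mul_assoc A', h', one_mul, h]

theorem isDual_list_ofFn_prod {r : ℕ} {f g : Fin r → LMat m} (h : ∀ i, IsDual (f i) (g i)) :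
    IsDual (List.ofFn f).prod (List.ofFn g).prod := by
  induction r with
  | zero => exact isDual_one
  | succ r ih =>
    simp only [List.ofFn_succ, List.prod_cons]
    exact (h 0).mul (ih fun i => h i.succ)

theorem isDual_list_ofFn_reverse_prod {r : ℕ} {f g : Fin r → LMat m}
    (h : ∀ i, IsDual (f i) (g i)) :
    IsDual (List.ofFn f).reverse.prod (List.ofFn g).reverse.prod := by
  induction r with
  | zero => exact isDual_one
  | succ r ih =>
    simp only [List.ofFn_succ, List.reverse_cons, List.prod_append, List.prod_singleton]
    exact (ih fun i => h i.succ).mul (h 0)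

theorem isDual_const {D E : Matrix (Fin m) (Fin m) ℂ} (h : D * Eᴴ = 1) :
    IsDual (const D) (const E) := by
  rw [IsDual, adj_const, ← const_mul, h, const_one]

theorem primitiveParaunitary_eq_leftFactor (v : Fin m → ℂ) :
    primitiveParaunitary v = leftFactor (Matrix.vecMulVec v (star v)) 1 := rfl

theorem isDual_primitiveParaunitary {v : Fin m → ℂ} (hv : IsUnitVector v) :
    IsDual (primitiveParaunitary v) (primitiveParaunitary v) := by
  have hstar : (Matrix.vecMulVec v (star v))ᴴ = Matrix.vecMulVec v (star v) := by
    rw [Matrix.conjTranspose_vecMulVec, star_star]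
  have hidem : const (Matrix.vecMulVec v (star v)) * const (Matrix.vecMulVec v (star v)) =
      const (Matrix.vecMulVec v (star v)) := by
    rw [← const_mul, Matrix.vecMulVec_mul_vecMulVec, hv, one_smul]
  have hz : zPow (-1) * zPow (- -1) = 1 := zPow_mul_zPow_neg _
  rw [IsDual, primitiveParaunitary, adj_add, adj_sub, adj_one, adj_zPow_smul, adj_const, hstar]
  simp only [add_mul, sub_mul, mul_add, mul_sub, one_mul, mul_one, Matrix.smul_mul,
    Matrix.mul_smul, hidem, smul_smul, mul_comm (zPow (- -1)), hz, one_smul]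
  abel

theorem isDual_leftFactor_rightFactor {N : Matrix (Fin m) (Fin m) ℂ} (hN : N ^ 2 = 0) (k : ℕ) :
    IsDual (leftFactor N k) (rightFactor N k) := by
  have hNN : const N * const N = 0 := by rw [← const_mul, ← sq, hN, const_zero]
  rw [IsDual, leftFactor, rightFactor, adj_sub, adj_add, adj_one, adj_zPow_smul, adj_const,
    Matrix.conjTranspose_conjTranspose]
  simp only [add_mul, sub_mul, mul_add, mul_sub, one_mul, mul_one, Matrix.smul_mul,
    Matrix.mul_smul, hNN, smul_zero]
  abel

theorem isUnit_natCast_laurentPolynomial (hm : m ≠ 0) : IsUnit (m : ℂ[T;T⁻¹]) := by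
  rw [← map_natCast (LaurentPolynomial.C (R := ℂ))]
  exact (Nat.cast_ne_zero.2 hm).isUnit.map _

theorem isUnit_of_mul_eq_natCast_smul_one (hm : m ≠ 0) {A B : LMat m}
    (h : A * B = (m : ℂ[T;T⁻¹]) • (1 : LMat m)) : IsUnit A := by
  rw [Matrix.isUnit_iff_isUnit_det]
  refine isUnit_of_mul_isUnit_left (y := B.det) ?_
  rw [← Matrix.det_mul, h, Matrix.det_smul, Matrix.det_one, mul_one]
  exact (isUnit_natCast_laurentPolynomial hm).pow _

theorem adj_injective : Function.Injective (adj (m := m)) :=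
  Function.LeftInverse.injective adj_adj

theorem eq_of_mul_adj_eq (hm : m ≠ 0) {L R R' : LMat m}
    (h : L * adj R = (m : ℂ[T;T⁻¹]) • (1 : LMat m))
    (h' : L * adj R' = (m : ℂ[T;T⁻¹]) • (1 : LMat m)) : R = R' :=
  adj_injective ((isUnit_of_mul_eq_natCast_smul_one hm h).mul_left_cancel (h.trans h'.symm))

end Duality

section ValueAtOne

variable {m : ℕ}

/-- The value of a Laurent polynomial at `z = 1`. -/
def evalLaurent : ℂ[T;T⁻¹] →+* ℂ := LaurentPolynomial.eval₂ (RingHom.id ℂ) 1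

theorem evalLaurent_C (a : ℂ) : evalLaurent (LaurentPolynomial.C a) = a := by
  simp [evalLaurent]

theorem evalLaurent_zPow (n : ℤ) : evalLaurent (zPow n) = 1 := by
  simp [evalLaurent, zPow]

theorem evalLaurent_eq_sum (f : ℂ[T;T⁻¹]) : evalLaurent f = f.coeff.sum fun _ a => a := by
  induction f using LaurentPolynomial.induction_on' with
  | add p q hp hq =>
    rw [map_add, hp, hq, AddMonoidAlgebra.coeff_add, Finsupp.sum_add_index'] <;> simp
  | C_mul_T n a =>
    rw [map_mul, evalLaurent_C, ← zPow, evalLaurent_zPow, mul_one, zPow,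
      ← LaurentPolynomial.single_eq_C_mul_T, AddMonoidAlgebra.coeff_single,
      Finsupp.sum_single_index rfl]

theorem evalLaurent_conjInvert (f : ℂ[T;T⁻¹]) :
    evalLaurent (conjInvert f) = starRingEnd ℂ (evalLaurent f) := by
  induction f using LaurentPolynomial.induction_on' with
  | add p q hp hq => simp only [map_add, hp, hq]
  | C_mul_T n a =>
    change evalLaurent (conjInvert (LaurentPolynomial.C a * zPow n)) =
      starRingEnd ℂ (evalLaurent (LaurentPolynomial.C a * zPow n))
    simp only [map_mul, conjInvert_C, conjInvert_zPow, evalLaurent_C, evalLaurent_zPow, map_one]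

/-- The value of a matrix of Laurent polynomials at `z = 1`. -/
def atOne : LMat m →+* Matrix (Fin m) (Fin m) ℂ := evalLaurent.mapMatrix

theorem atOne_adj (A : LMat m) : atOne (adj A) = (atOne A)ᴴ := by
  ext i j
  simp [atOne, adj_apply, evalLaurent_conjInvert]

theorem atOne_zPow_smul (n : ℤ) (A : LMat m) : atOne (zPow n • A) = atOne A := by
  ext i j
  simp [atOne, evalLaurent_zPow]

theorem atOne_const (A : Matrix (Fin m) (Fin m) ℂ) : atOne (const A) = A := by
  ext i j
  simp [atOne, const, evalLaurent_C]

theorem atOne_leftFactor (N : Matrix (Fin m) (Fin m) ℂ) (k : ℕ) : atOne (leftFactor N k) = 1 := by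
  rw [leftFactor, map_add, map_sub, map_one, atOne_zPow_smul, atOne_const, sub_add_cancel]

theorem atOne_rightFactor (N : Matrix (Fin m) (Fin m) ℂ) (k : ℕ) :
    atOne (rightFactor N k) = 1 := by
  rw [rightFactor, map_sub, map_add, map_one, atOne_zPow_smul, atOne_const, add_sub_cancel_right]

theorem atOne_primitiveParaunitary (v : Fin m → ℂ) : atOne (primitiveParaunitary v) = 1 :=
  atOne_leftFactor _ _

theorem rowSum_eq_mulVec_one (A : LMat m) (i : Fin m) : rowSum A i = (atOne A *ᵥ 1) i := by
  rw [rowSum, Finset.sum_comm]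
  simp only [Matrix.mulVec, dotProduct, Pi.one_apply, mul_one]
  refine Finset.sum_congr rfl fun j _ => ?_
  change _ = evalLaurent (A i j)
  rw [evalLaurent_eq_sum, Finsupp.sum_of_support_subset
    (s := (blockSupport A).image fun k => -k), Finset.sum_image (by simp)]
  · rfl
  · intro n hn
    refine Finset.mem_image.2 ⟨-n, (mem_blockSupport A _).2 fun h0 => ?_, neg_neg n⟩
    refine Finsupp.mem_support_iff.1 hn ?_
    simpa [block] using congrFun (congrFun h0 i) j
  · exact fun _ _ => rfl

theorem rowSum_eq_ite_iff [NeZero m] (A : LMat m) :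
    (∀ i : Fin m, rowSum A i = if (i : ℕ) = 0 then (m : ℂ) else 0) ↔
      atOne A *ᵥ 1 = Pi.single 0 (m : ℂ) := by
  simp only [funext_iff, rowSum_eq_mulVec_one, Pi.single_apply, Fin.val_eq_zero_iff]

end ValueAtOne

section Haar

variable {m : ℕ}

theorem canonicalHaar_zero {i : Fin m} (hi : (i : ℕ) = 0) (j : Fin m) :
    canonicalHaar m i j = 1 := by
  simp [canonicalHaar, hi]

theorem canonicalHaar_of_lt {i j : Fin m} (h : (j : ℕ) + 1 < (i : ℕ)) :
    canonicalHaar m i j = 0 := by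
  have hi : (i : ℕ) ≠ 0 := by lia
  simp [canonicalHaar, hi, h]

theorem canonicalHaar_of_eq {i j : Fin m} (h : (j : ℕ) + 1 = (i : ℕ)) :
    canonicalHaar m i j = -((m : ℂ) - (i : ℕ)) *
      (√((m : ℝ) / (((m : ℝ) - (i : ℕ)) ^ 2 + ((m : ℝ) - (i : ℕ)))) : ℝ) := by
  have hi : (i : ℕ) ≠ 0 := by lia
  simp [canonicalHaar, hi, h]

theorem canonicalHaar_of_le {i j : Fin m} (hi : (i : ℕ) ≠ 0) (h : (i : ℕ) ≤ (j : ℕ)) :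
    canonicalHaar m i j =
      (√((m : ℝ) / (((m : ℝ) - (i : ℕ)) ^ 2 + ((m : ℝ) - (i : ℕ)))) : ℝ) := by
  have h₁ : ¬ (j : ℕ) + 1 < (i : ℕ) := by lia
  have h₂ : (j : ℕ) + 1 ≠ (i : ℕ) := by lia
  simp [canonicalHaar, hi, h₁, h₂]

theorem sum_eq_add_sub_mul {M : Type*} [Ring M] {i : Fin m} (hi : (i : ℕ) ≠ 0) {f : Fin m → M}
    {a b : M} (h_lt : ∀ j : Fin m, (j : ℕ) + 1 < i → f j = 0)
    (h_eq : ∀ j : Fin m, (j : ℕ) + 1 = i → f j = a) (h_le : ∀ j : Fin m, i ≤ j → f j = b) :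
    ∑ j, f j = a + ((m : M) - (i : ℕ)) * b := by
  let p : Fin m := ⟨(i : ℕ) - 1, by lia⟩
  have hf : ∀ j, f j = (if j = p then a else 0) + if i ≤ j then b else 0 := by
    intro j
    rcases lt_trichotomy ((j : ℕ) + 1) i with h | h | h
    · rw [h_lt j h, if_neg (by simp only [Fin.ext_iff, p]; lia), if_neg (by lia), add_zero]
    · rw [h_eq j h, if_pos (by simp only [Fin.ext_iff, p]; lia), if_neg (by lia), add_zero]
    · rw [h_le j (by lia), if_neg (by simp only [Fin.ext_iff, p]; lia), if_pos (by lia), zero_add]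
  simp only [hf, Finset.sum_add_distrib, Finset.sum_ite_eq', Finset.mem_univ, if_true]
  rw [← Finset.sum_filter, Finset.sum_const, Finset.filter_le_eq_Ici, Fin.card_Ici, nsmul_eq_mul,
    Nat.cast_sub i.2.le]

theorem sum_canonicalHaar (i : Fin m) :
    ∑ j, canonicalHaar m i j = if (i : ℕ) = 0 then (m : ℂ) else 0 := by
  split_ifs with hi
  · simp [canonicalHaar_zero hi]
  · rw [sum_eq_add_sub_mul hi (fun _ => canonicalHaar_of_lt) (fun _ => canonicalHaar_of_eq)
      (fun _ => canonicalHaar_of_le hi)]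
    ring

theorem star_canonicalHaar (i j : Fin m) : star (canonicalHaar m i j) = canonicalHaar m i j := by
  simp only [canonicalHaar, Matrix.of_apply]
  split_ifs <;> simp

theorem sum_canonicalHaar_mul_of_lt {i j : Fin m} (h : i < j) :
    ∑ k, canonicalHaar m i k * canonicalHaar m j k = 0 := by
  have hj : (j : ℕ) ≠ 0 := by lia
  -- the row `i` is constant on the support of the row `j`, and the row `j` has sum `0`
  obtain ⟨c, hc⟩ : ∃ c : ℂ, ∀ k : Fin m, (j : ℕ) ≤ (k : ℕ) + 1 → canonicalHaar m i k = c := by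
    by_cases hi : (i : ℕ) = 0
    · exact ⟨1, fun k _ => canonicalHaar_zero hi k⟩
    · exact ⟨_, fun k hk => canonicalHaar_of_le hi (by lia)⟩
  have hterm : ∀ k, canonicalHaar m i k * canonicalHaar m j k = c * canonicalHaar m j k := by
    intro k
    rcases Nat.lt_or_ge ((k : ℕ) + 1) j with hk | hk
    · rw [canonicalHaar_of_lt hk, mul_zero, mul_zero]
    · rw [hc k hk]
  rw [Finset.sum_congr rfl fun k _ => hterm k, ← Finset.mul_sum, sum_canonicalHaar, if_neg hj,
    mul_zero]

theorem sum_canonicalHaar_mul_self (i : Fin m) :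
    ∑ k, canonicalHaar m i k * canonicalHaar m i k = m := by
  by_cases hi : (i : ℕ) = 0
  · simp [canonicalHaar_zero hi]
  set s : ℝ := (m : ℝ) - (i : ℕ) with hs
  have hs_pos : 0 < s := sub_pos.2 (Nat.cast_lt.2 i.2)
  have hsc : (m : ℂ) - (i : ℕ) = (s : ℂ) := by simp [hs]
  have hsq : ((√((m : ℝ) / (s ^ 2 + s)) : ℝ) : ℂ) * (√((m : ℝ) / (s ^ 2 + s)) : ℝ) =
      (((m : ℝ) / (s ^ 2 + s) : ℝ) : ℂ) := by
    rw [← Complex.ofReal_mul, Real.mul_self_sqrt (by positivity)]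
  have h_eq : ∀ k : Fin m, (k : ℕ) + 1 = i → canonicalHaar m i k * canonicalHaar m i k =
      s * s * (((m : ℝ) / (s ^ 2 + s) : ℝ) : ℂ) := by
    intro k h
    rw [canonicalHaar_of_eq h, hsc, ← hs, ← hsq]
    ring
  have h_le : ∀ k : Fin m, i ≤ k → canonicalHaar m i k * canonicalHaar m i k =
      (((m : ℝ) / (s ^ 2 + s) : ℝ) : ℂ) := by
    intro k h
    rw [canonicalHaar_of_le hi h, ← hs, hsq]
  rw [sum_eq_add_sub_mul hi (fun k h => by rw [canonicalHaar_of_lt h, mul_zero]) h_eq h_le, hsc]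
  norm_cast
  field_simp

theorem canonicalHaar_mul_conjTranspose :
    canonicalHaar m * (canonicalHaar m)ᴴ = (m : ℂ) • (1 : Matrix (Fin m) (Fin m) ℂ) := by
  ext i j
  simp only [Matrix.mul_apply, Matrix.conjTranspose_apply, star_canonicalHaar, Matrix.smul_apply,
    Matrix.one_apply, smul_eq_mul]
  rcases lt_trichotomy i j with h | rfl | h
  · rw [sum_canonicalHaar_mul_of_lt h, if_neg h.ne, mul_zero]
  · rw [sum_canonicalHaar_mul_self, if_pos rfl, mul_one]
  · simp only [mul_comm (canonicalHaar m i _)]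
    rw [sum_canonicalHaar_mul_of_lt h, if_neg h.ne', mul_zero]

theorem conjTranspose_canonicalHaar_mul [NeZero m] :
    (canonicalHaar m)ᴴ * canonicalHaar m = (m : ℂ) • (1 : Matrix (Fin m) (Fin m) ℂ) := by
  have hm : (m : ℂ) ≠ 0 := NeZero.ne _
  have h : ((m : ℂ)⁻¹ • (canonicalHaar m)ᴴ) * canonicalHaar m = 1 := by
    rw [mul_eq_one_comm, Matrix.mul_smul, canonicalHaar_mul_conjTranspose, smul_smul,
      inv_mul_cancel₀ hm, one_smul]
  rw [← h, Matrix.smul_mul, smul_smul, mul_inv_cancel₀ hm, one_smul]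

theorem canonicalHaar_mulVec_one [NeZero m] :
    canonicalHaar m *ᵥ 1 = Pi.single 0 (m : ℂ) := by
  ext i
  simp only [Matrix.mulVec, dotProduct, Pi.one_apply, mul_one, sum_canonicalHaar, Pi.single_apply,
    Fin.val_eq_zero_iff]

theorem conjTranspose_canonicalHaar_mulVec_single [NeZero m] :
    (canonicalHaar m)ᴴ *ᵥ Pi.single 0 1 = 1 := by
  ext i
  rw [Matrix.mulVec_single_one, Matrix.col_apply, Matrix.conjTranspose_apply,
    canonicalHaar_zero rfl, star_one, Pi.one_apply]

end Haar

section DiagOne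

variable {m : ℕ}

theorem diagOne_mul (G G' : Matrix (Fin (m - 1)) (Fin (m - 1)) ℂ) :
    diagOne (m := m) G * diagOne G' = diagOne (G * G') := by
  cases m with
  | zero => exact Subsingleton.elim _ _
  | succ n =>
    ext i j
    rw [Matrix.mul_apply, Fin.sum_univ_succ]
    cases i using Fin.cases <;> cases j using Fin.cases <;> simp [diagOne, Matrix.mul_apply]

theorem diagOne_one : diagOne (m := m) 1 = 1 := by
  ext i j
  simp only [diagOne, Matrix.of_apply, Matrix.one_apply, Fin.ext_iff]
  grind

theorem conjTranspose_diagOne (G : Matrix (Fin (m - 1)) (Fin (m - 1)) ℂ) :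
    (diagOne (m := m) G)ᴴ = diagOne Gᴴ := by
  ext i j
  simp only [diagOne, Matrix.conjTranspose_apply, Matrix.of_apply]
  split_ifs <;> simp

theorem det_diagOne [NeZero m] (G : Matrix (Fin (m - 1)) (Fin (m - 1)) ℂ) :
    (diagOne (m := m) G).det = G.det := by
  obtain ⟨n, rfl⟩ := Nat.exists_eq_add_one_of_ne_zero (NeZero.ne m)
  have hsub : (diagOne (m := n + 1) G).submatrix Fin.succ Fin.succ = G := by
    ext i j
    simp [diagOne]
  rw [Matrix.det_succ_row_zero, Fin.sum_univ_succ, Fin.succAbove_zero, hsub]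
  simp [diagOne]

theorem diagOne_mulVec_single [NeZero m] (G : Matrix (Fin (m - 1)) (Fin (m - 1)) ℂ) (c : ℂ) :
    diagOne (m := m) G *ᵥ Pi.single 0 c = Pi.single 0 c := by
  ext i
  rw [Matrix.mulVec, dotProduct_single, Pi.single_apply]
  simp only [diagOne, Matrix.of_apply, Fin.val_eq_zero_iff]
  split_ifs <;> simp_all

/-- The lower right block of a square matrix; it recovers `G` from `diag(1, G)`. -/
def lowerBlock {R : Type*} (A : Matrix (Fin m) (Fin m) R) : Matrix (Fin (m - 1)) (Fin (m - 1)) R :=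
  Matrix.of fun i j => A ⟨i + 1, by lia⟩ ⟨j + 1, by lia⟩

theorem diagOne_lowerBlock [NeZero m] {D : Matrix (Fin m) (Fin m) ℂ}
    (hcol : D *ᵥ Pi.single 0 1 = Pi.single 0 1) (hrow : Pi.single 0 1 ᵥ* D = Pi.single 0 1) :
    diagOne (lowerBlock D) = D := by
  obtain ⟨n, rfl⟩ := Nat.exists_eq_add_one_of_ne_zero (NeZero.ne m)
  rw [Matrix.mulVec_single_one] at hcol
  rw [Matrix.single_one_vecMul] at hrow
  ext i j
  cases i using Fin.cases with
  | zero => simpa [diagOne, Pi.single_apply] using (congrFun hrow j).symm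
  | succ i =>
    cases j using Fin.cases with
    | zero => simpa [diagOne] using (congrFun hcol i.succ).symm
    | succ j =>
      simp only [diagOne, lowerBlock, Matrix.of_apply]
      rfl

theorem diagOne_lowerBlock_of_mul_conjTranspose_eq_one [NeZero m]
    {D E : Matrix (Fin m) (Fin m) ℂ} (hDE : D * Eᴴ = 1)
    (hD : D *ᵥ Pi.single 0 1 = Pi.single 0 1) (hE : E *ᵥ Pi.single 0 1 = Pi.single 0 1) :
    diagOne (lowerBlock D) = D := by
  refine diagOne_lowerBlock hD ?_
  have hE' : Pi.single 0 1 ᵥ* Eᴴ = Pi.single (0 : Fin m) (1 : ℂ) := by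
    have hstar : star (Pi.single 0 1 : Fin m → ℂ) = Pi.single 0 1 := by
      rw [← Pi.single_star, star_one]
    rw [← hstar, ← Matrix.star_mulVec, hE]
  rw [← hE', Matrix.vecMul_vecMul, mul_eq_one_comm.1 hDE, Matrix.vecMul_one, hE']

theorem isUnit_det_and_eq_diagOne_mul_canonicalHaar [NeZero m] {A B : Matrix (Fin m) (Fin m) ℂ}
    (hAB : A * Bᴴ = (m : ℂ) • (1 : Matrix (Fin m) (Fin m) ℂ))
    (hA : A *ᵥ 1 = Pi.single 0 (m : ℂ)) (hB : B *ᵥ 1 = Pi.single 0 (m : ℂ)) :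
    IsUnit (lowerBlock ((m : ℂ)⁻¹ • (A * (canonicalHaar m)ᴴ))).det ∧
      A = diagOne (lowerBlock ((m : ℂ)⁻¹ • (A * (canonicalHaar m)ᴴ))) * canonicalHaar m := by
  have hm : (m : ℂ) ≠ 0 := NeZero.ne _
  set H := canonicalHaar m with hH
  have hfix : ∀ X : Matrix (Fin m) (Fin m) ℂ, X *ᵥ 1 = Pi.single 0 (m : ℂ) →
      ((m : ℂ)⁻¹ • (X * Hᴴ)) *ᵥ Pi.single 0 1 = Pi.single 0 1 := by
    intro X hX
    rw [Matrix.smul_mulVec, ← Matrix.mulVec_mulVec, hH, conjTranspose_canonicalHaar_mulVec_single,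
      hX, ← Pi.single_smul, smul_eq_mul, inv_mul_cancel₀ hm]
  have hDE : ((m : ℂ)⁻¹ • (A * Hᴴ)) * ((m : ℂ)⁻¹ • (B * Hᴴ))ᴴ = 1 := by
    rw [Matrix.conjTranspose_smul, Matrix.conjTranspose_mul, Matrix.conjTranspose_conjTranspose,
      Matrix.smul_mul, Matrix.mul_smul, mul_assoc, ← mul_assoc Hᴴ,
      conjTranspose_canonicalHaar_mul, Matrix.smul_mul, one_mul, Matrix.mul_smul, hAB]
    simp [smul_smul, hm]
  have hdiag := diagOne_lowerBlock_of_mul_conjTranspose_eq_one hDE (hfix A hA) (hfix B hB)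
  constructor
  · rw [← det_diagOne, hdiag]
    exact Matrix.isUnit_det_of_right_inverse hDE
  · rw [hdiag, Matrix.smul_mul, mul_assoc, conjTranspose_canonicalHaar_mul, Matrix.mul_smul,
      mul_one, smul_smul, inv_mul_cancel₀ hm, one_smul]

end DiagOne

section Genus

variable {m : ℕ} {A : LMat m}

theorem nonempty_blockSupport (hA : A ≠ 0) : (blockSupport A).Nonempty := by
  by_contra hempty
  refine hA ?_
  ext i j k
  have hk : block A (-k) = 0 := by
    by_contra hne
    exact hempty ⟨-k, (mem_blockSupport A _).2 hne⟩
  simpa [block] using congrFun (congrFun hk i) j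

theorem exists_genus_eq_add_one (hA : A ≠ 0) :
    ∃ (k₀ : ℤ) (n : ℕ), genus A = n + 1 ∧ ∀ k, block A k ≠ 0 → k₀ ≤ k ∧ k ≤ k₀ + n := by
  have hne := nonempty_blockSupport hA
  have hle := (blockSupport A).min'_le _ ((blockSupport A).max'_mem hne)
  refine ⟨(blockSupport A).min' hne,
    ((blockSupport A).max' hne - (blockSupport A).min' hne).toNat, ?_, fun k hk => ?_⟩
  · rw [genus, dif_pos hne]
    lia
  · have hmem := (mem_blockSupport A k).2 hk
    have h_min := (blockSupport A).min'_le _ hmem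
    have h_max := (blockSupport A).le_max' _ hmem
    lia

theorem genus_le_add_one {k₀ : ℤ} {n : ℕ} (h : ∀ k, block A k ≠ 0 → k₀ ≤ k ∧ k ≤ k₀ + n) :
    genus A ≤ n + 1 := by
  unfold genus
  split_ifs with hne
  · have h_min := h _ ((mem_blockSupport A _).1 ((blockSupport A).min'_mem hne))
    have h_max := h _ ((mem_blockSupport A _).1 ((blockSupport A).max'_mem hne))
    lia
  · exact Nat.zero_le _

end Genus

section Embedding

open Polynomial

variable (F : Subfield ℂ)

/-- The embedding `F[X] → ℂ[z, z⁻¹]` that sends `X` to `z⁻¹`; it turns the expansions in powers of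
`z⁻¹` into polynomials. -/
def embed : F[X] →+* ℂ[T;T⁻¹] :=
  ((LaurentPolynomial.invert (R := ℂ) : ℂ[T;T⁻¹] →+* ℂ[T;T⁻¹]).comp toLaurent).comp
    (mapRingHom F.subtype)

theorem embed_apply (p : F[X]) :
    embed F p = LaurentPolynomial.invert (toLaurent (p.map F.subtype)) := rfl

theorem embed_C (a : F) : embed F (C a) = LaurentPolynomial.C (a : ℂ) := by
  simp [embed_apply]

theorem embed_X_pow (k : ℕ) : embed F (X ^ k) = zPow (-(k : ℤ)) := by
  simp [embed_apply, zPow]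

theorem coeff_embed_neg_natCast (p : F[X]) (k : ℕ) :
    (embed F p).coeff (-(k : ℤ)) = (p.coeff k : ℂ) := by
  rw [embed_apply, LaurentPolynomial.invert_apply, neg_neg, LaurentPolynomial.coeff_toLaurent]
  exact (Finsupp.mapDomain_apply Nat.castEmbedding.injective _ k).trans (coeff_map F.subtype k)

theorem coeff_embed_of_pos (p : F[X]) {k : ℤ} (hk : 0 < k) : (embed F p).coeff k = 0 := by
  rw [embed_apply, LaurentPolynomial.invert_apply, LaurentPolynomial.coeff_toLaurent]
  exact Finsupp.mapDomain_of_notMem_range _ _ (by simp; lia)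

theorem evalLaurent_embed (p : F[X]) : evalLaurent (embed F p) = (p.eval 1 : F) := by
  have h : evalLaurent.comp (embed F) = F.subtype.comp (evalRingHom 1) := by
    ext
    · simp [embed_C, evalLaurent_C]
    · simpa [evalLaurent_zPow] using congrArg evalLaurent (embed_X_pow F 1)
  exact DFunLike.congr_fun h p

theorem eq_C_mul_X_pow_of_isUnit_embed {p : F[X]} (hp : IsUnit (embed F p)) :
    ∃ (c : F) (d : ℕ), c ≠ 0 ∧ p = C c * X ^ d := by
  obtain ⟨q, hq⟩ := hp.exists_right_inv
  obtain ⟨n, f, hf⟩ := (LaurentPolynomial.invert q).exists_T_pow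
  have hinv : toLaurent (p.map F.subtype) * LaurentPolynomial.invert q = 1 := by
    simpa [embed_apply, LaurentPolynomial.involutive_invert _] using
      congrArg LaurentPolynomial.invert hq
  have hmul : p.map F.subtype * f = X ^ n := by
    apply toLaurent_injective
    rw [map_mul, hf, ← mul_assoc, hinv, one_mul, toLaurent_X_pow]
  have hdvd : p ∣ X ^ n := by
    rw [← Polynomial.map_dvd_map' F.subtype, Polynomial.map_pow, Polynomial.map_X, ← hmul]
    exact dvd_mul_right _ _
  obtain ⟨d, -, u, hu⟩ := (dvd_prime_pow Polynomial.prime_X n).1 hdvd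
  obtain ⟨c, hc, hcu⟩ := Polynomial.isUnit_iff.1 u⁻¹.isUnit
  exact ⟨c, d, hc.ne_zero, by rw [hcu, ← hu, mul_left_comm, Units.inv_mul, mul_one]⟩

theorem coeff_zPow_mul (n : ℤ) (f : ℂ[T;T⁻¹]) (k : ℤ) :
    (zPow n * f).coeff (n + k) = f.coeff k := by
  rw [zPow, LaurentPolynomial.T, AddMonoidAlgebra.coeff_single_mul_add, one_mul]

theorem exists_eq_zPow_mul_embed {f : F[T;T⁻¹]} {k₀ : ℤ} {n : ℕ}
    (hf : ∀ k, f.coeff (-k) ≠ 0 → k₀ ≤ k ∧ k ≤ k₀ + n) :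
    ∃ p : F[X], p.natDegree ≤ n ∧
      AddMonoidAlgebra.mapRingHom ℤ F.subtype f = zPow (-k₀) * embed F p := by
  have hf0 : ∀ k, (k < k₀ ∨ k₀ + n < k) → f.coeff (-k) = 0 := fun k hk => by
    by_contra h
    have := hf k h
    lia
  refine ⟨ofFn (n + 1) fun l => f.coeff (-(k₀ + l)),
    Nat.le_of_lt_succ (ofFn_natDegree_lt (by lia) _), ?_⟩
  ext k
  obtain ⟨l, rfl⟩ : ∃ l, k = -k₀ + -l := ⟨-k - k₀, by ring⟩
  rw [coeff_zPow_mul, AddMonoidAlgebra.coeff_mapRingHom, ← neg_add]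
  rcases lt_or_ge l 0 with hneg | hnonneg
  · rw [coeff_embed_of_pos F _ (by lia), hf0 _ (by lia), map_zero]
  lift l to ℕ using hnonneg
  rw [coeff_embed_neg_natCast]
  rcases lt_or_ge l (n + 1) with hlt | hge
  · rw [ofFn_coeff_eq_val_of_lt _ hlt]
    rfl
  · rw [ofFn_coeff_eq_zero_of_ge _ hge, hf0 _ (by lia)]
    rfl

variable {F} {m : ℕ}

theorem embed_shiftFactor (N : Matrix (Fin m) (Fin m) F) (k : ℕ) :
    (embed F).mapMatrix (shiftFactor N k) = leftFactor (N.map F.subtype) k := by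
  ext1 i j
  by_cases h : i = j <;>
    simp [shiftFactor, leftFactor, const, h, embed_C, -map_pow, embed_X_pow, mul_comm (zPow _)]

theorem embed_list_ofFn_prod_shiftFactor {r : ℕ} (N : Fin r → Matrix (Fin m) (Fin m) F)
    (k : Fin r → ℕ) :
    (embed F).mapMatrix (List.ofFn fun i => shiftFactor (N i) (k i)).prod =
      (List.ofFn fun i => leftFactor ((N i).map F.subtype) (k i)).prod := by
  rw [map_list_prod, List.map_ofFn]
  simp only [Function.comp_def, embed_shiftFactor]

theorem embed_list_ofFn_reverse_prod_shiftFactor {r : ℕ} (N : Fin r → Matrix (Fin m) (Fin m) F)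
    (k : Fin r → ℕ) :
    (embed F).mapMatrix (List.ofFn fun i => shiftFactor (N i) (k i)).reverse.prod =
      (List.ofFn fun i => leftFactor ((N i).map F.subtype) (k i)).reverse.prod := by
  rw [map_list_prod, List.map_reverse, List.map_ofFn]
  simp only [Function.comp_def, embed_shiftFactor]

theorem embed_mapMatrix_C (A : Matrix (Fin m) (Fin m) F) :
    (embed F).mapMatrix (C.mapMatrix A) = const (A.map F.subtype) := by
  ext1 i j
  simp [const, embed_C]

theorem atOne_embed (P : Matrix (Fin m) (Fin m) F[X]) :
    atOne ((embed F).mapMatrix P) = (evalOne P).map F.subtype := by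
  ext i j
  simp [atOne, evalOne, evalLaurent_embed]

theorem genus_embed_le {P : Matrix (Fin m) (Fin m) F[X]} {n : ℕ}
    (h : ∀ i j, (P i j).natDegree ≤ n) : genus ((embed F).mapMatrix P) ≤ n + 1 := by
  refine genus_le_add_one (k₀ := 0) fun k hk => ?_
  contrapose! hk
  ext i j
  change (embed F (P i j)).coeff (-k) = 0
  rcases lt_or_ge k 0 with hneg | hnonneg
  · exact coeff_embed_of_pos F _ (by lia)
  · lift k to ℕ using hnonneg
    rw [coeff_embed_neg_natCast, coeff_eq_zero_of_natDegree_lt ((h i j).trans_lt (by lia)),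
      ZeroMemClass.coe_zero]

theorem exists_eq_zPow_smul_embed {L : Matrix (Fin m) (Fin m) F[T;T⁻¹]}
    (hL : toComplex F L ≠ 0) :
    ∃ (k₀ : ℤ) (n : ℕ) (P : Matrix (Fin m) (Fin m) F[X]), genus (toComplex F L) = n + 1 ∧
      (∀ i j, (P i j).natDegree ≤ n) ∧ toComplex F L = zPow (-k₀) • (embed F).mapMatrix P := by
  obtain ⟨k₀, n, hgenus, hk₀⟩ := exists_genus_eq_add_one hL
  have hentry : ∀ i j k, (L i j).coeff (-k) ≠ 0 → k₀ ≤ k ∧ k ≤ k₀ + n := by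
    intro i j k hk
    refine hk₀ k fun hzero => hk ?_
    simpa [block, toComplex] using congrFun (congrFun hzero i) j
  choose P hP hLP using fun i j => exists_eq_zPow_mul_embed F (hentry i j)
  exact ⟨k₀, n, Matrix.of P, hgenus, hP, Matrix.ext hLP⟩

theorem isDetExponent_zPow_smul_embed {P : Matrix (Fin m) (Fin m) F[X]} {c : F} (hc : c ≠ 0)
    {d : ℕ} (hdet : P.det = C c * X ^ d) (k₀ : ℤ) :
    IsDetExponent (zPow (-k₀) • (embed F).mapMatrix P) (d + m * k₀) := by
  refine ⟨c, by simpa using hc, ?_⟩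
  rw [Matrix.det_smul, Fintype.card_fin, ← RingHom.map_det, hdet, map_mul, embed_C, embed_X_pow,
    mul_left_comm, zPow, zPow, zPow, LaurentPolynomial.T_pow, ← LaurentPolynomial.T_add]
  congr 2
  ring

end Embedding

section Sufficiency

variable {F : Subfield ℂ} {m : ℕ}

theorem isDual_const_diagOne (G : Matrix.GeneralLinearGroup (Fin (m - 1)) F) :
    IsDual (m := m) (const (diagOne ((G : Matrix (Fin (m - 1)) (Fin (m - 1)) F).map F.subtype)))
      (const (diagOne (((G⁻¹ : Matrix.GeneralLinearGroup (Fin (m - 1)) F) :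
        Matrix (Fin (m - 1)) (Fin (m - 1)) F).map F.subtype)ᴴ)) :=
  isDual_const <| by
    rw [conjTranspose_diagOne, Matrix.conjTranspose_conjTranspose, diagOne_mul,
      ← Matrix.map_mul, Units.mul_inv, Matrix.map_one _ (map_zero _) (map_one _), diagOne_one]

theorem zPow_smul_mul_const_canonicalHaar_mul_adj {A B : LMat m} (h : IsDual A B) (n : ℤ) :
    (zPow n • (A * const (canonicalHaar m))) * adj (zPow n • (B * const (canonicalHaar m))) =
      (m : ℂ[T;T⁻¹]) • (1 : LMat m) := by
  rw [zPow_smul_mul_adj_zPow_smul, adj_mul, adj_const, mul_assoc, ← mul_assoc (const _),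
    ← const_mul, canonicalHaar_mul_conjTranspose, const_natCast_smul_one, Matrix.smul_mul, one_mul,
    Matrix.mul_smul, h]

theorem isDual_factors {d r : ℕ} {v : Fin d → Fin m → ℂ} (hv : ∀ s, IsUnitVector (v s))
    {N : Fin r → Matrix (Fin m) (Fin m) F} (hN : ∀ i, N i ^ 2 = 0) (k : Fin r → ℕ)
    (G : Matrix.GeneralLinearGroup (Fin (m - 1)) F) :
    IsDual
      ((List.ofFn fun s => primitiveParaunitary (v s)).prod *
        (List.ofFn fun i => leftFactor ((N i).map F.subtype) (k i)).reverse.prod *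
        const (diagOne ((G : Matrix (Fin (m - 1)) (Fin (m - 1)) F).map F.subtype)))
      ((List.ofFn fun s => primitiveParaunitary (v s)).prod *
        (List.ofFn fun i => rightFactor ((N i).map F.subtype) (k i)).reverse.prod *
        const (diagOne (((G⁻¹ : Matrix.GeneralLinearGroup (Fin (m - 1)) F) :
          Matrix (Fin (m - 1)) (Fin (m - 1)) F).map F.subtype)ᴴ)) :=
  ((isDual_list_ofFn_prod fun s => isDual_primitiveParaunitary (hv s)).mul
    (isDual_list_ofFn_reverse_prod fun i => isDual_leftFactor_rightFactor
      (by rw [← RingHom.mapMatrix_apply, ← map_pow, hN, map_zero]) (k i))).mul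
    (isDual_const_diagOne G)

theorem atOne_list_prod_eq_one {l : List (LMat m)} (h : ∀ A ∈ l, atOne A = 1) :
    atOne l.prod = 1 := by
  rw [map_list_prod]
  exact List.prod_eq_one (by simpa using h)

theorem atOne_mulVec_one_of_factors [NeZero m] {l l' : List (LMat m)} (h : ∀ A ∈ l, atOne A = 1)
    (h' : ∀ A ∈ l', atOne A = 1) (n : ℤ) (G : Matrix (Fin (m - 1)) (Fin (m - 1)) ℂ) :
    atOne (zPow n • (l.prod * l'.prod * const (diagOne G) * const (canonicalHaar m))) *ᵥ 1 =
      Pi.single 0 (m : ℂ) := by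
  rw [atOne_zPow_smul, map_mul, map_mul, map_mul, atOne_list_prod_eq_one h,
    atOne_list_prod_eq_one h', atOne_const, atOne_const, one_mul, one_mul,
    ← Matrix.mulVec_mulVec, canonicalHaar_mulVec_one, diagOne_mulVec_single]

theorem HasFactorization.isBiorthogonalWaveletPair [NeZero m] {K : Subfield ℂ} {g : ℕ}
    {L R : LMat m} (h : HasFactorization F K g L R) : IsBiorthogonalWaveletPair L R := by
  obtain ⟨k₀, b, d, r, v, N, k, G, -, -, hv, -, -, -, hN, -, -, rfl, rfl⟩ := h
  refine ⟨zPow_smul_mul_const_canonicalHaar_mul_adj (isDual_factors hv hN k G) _,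
    (rowSum_eq_ite_iff _).2 (atOne_mulVec_one_of_factors ?_ ?_ _ _),
    (rowSum_eq_ite_iff _).2 (atOne_mulVec_one_of_factors ?_ ?_ _ _)⟩ <;>
  simp [List.mem_ofFn, atOne_primitiveParaunitary, atOne_leftFactor, atOne_rightFactor]

end Sufficiency

section UnitVectors

open Matrix (vecMulVec)

variable {m : ℕ}

theorem exists_smul_isUnitVector {w : Fin m → ℂ} (hw : w ≠ 0) : ∃ c : ℂ, IsUnitVector (c • w) := by
  have hnorm := norm_smul_inv_norm (𝕜 := ℂ) (show WithLp.toLp 2 w ≠ 0 by simpa using hw)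
  refine ⟨(‖WithLp.toLp 2 w‖ : ℂ)⁻¹, ?_⟩
  rw [IsUnitVector, dotProduct_comm]
  exact inner_self_eq_one_of_norm_eq_one hnorm

theorem vecMulVec_smul_star_of_isUnitVector {c : ℂ} {u : Fin m → ℂ} (h : IsUnitVector (c • u)) :
    star u ⬝ᵥ u ≠ 0 ∧
      vecMulVec (c • u) (star (c • u)) = vecMulVec ((star u ⬝ᵥ u)⁻¹ • u) (star u) := by
  have hmul : star c * c * (star u ⬝ᵥ u) = 1 := by
    rwa [IsUnitVector, star_smul, smul_dotProduct, dotProduct_smul, smul_smul] at h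
  refine ⟨right_ne_zero_of_mul_eq_one hmul, ?_⟩
  rw [star_smul, Matrix.vecMulVec_smul, Matrix.smul_vecMulVec, Matrix.smul_vecMulVec, smul_smul,
    eq_inv_of_mul_eq_one_left hmul]

theorem exists_rankOne_eq_vecMulVec_star {F K : Subfield ℂ} (hF : ∀ x ∈ F, starRingEnd ℂ x ∈ F)
    (hK : ∀ w : Fin m → ℂ, (∀ i, w i ∈ F) → w ≠ 0 →
      ∃ c : ℂ, IsUnitVector (c • w) ∧ ∀ i, (c • w) i ∈ K) {w : Fin m → F} (hw : w ≠ 0) :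
    ∃ (a : Fin m → F) (v : Fin m → ℂ), w ⬝ᵥ a = 1 ∧ IsUnitVector v ∧ (∀ i, v i ∈ K) ∧
      (vecMulVec a w).map F.subtype = vecMulVec v (star v) := by
  let u : Fin m → F := fun i => ⟨starRingEnd ℂ (w i), hF _ (w i).2⟩
  let u' : Fin m → ℂ := F.subtype ∘ u
  have hstar : star u' = F.subtype ∘ w := by
    ext i
    simp [u, u']
  have hu' : u' ≠ 0 := by
    obtain ⟨i, hi⟩ := Function.ne_iff.1 hw
    exact Function.ne_iff.2 ⟨i, by simpa [u, u'] using hi⟩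
  obtain ⟨c, hc, hcK⟩ := hK u' (fun i => (u i).2) hu'
  obtain ⟨hne, hproj⟩ := vecMulVec_smul_star_of_isUnitVector hc
  have hdot : star u' ⬝ᵥ u' = F.subtype (w ⬝ᵥ u) := by
    rw [hstar, RingHom.map_dotProduct]
  rw [hdot] at hne hproj
  refine ⟨(w ⬝ᵥ u)⁻¹ • u, c • u', ?_, hc, hcK, ?_⟩
  · rw [dotProduct_smul, smul_eq_mul, inv_mul_cancel₀ (ne_zero_of_map hne)]
  · rw [hproj, hstar]
    ext i j
    simp [u', Matrix.vecMulVec_apply, mul_assoc]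

end UnitVectors

section Necessity

variable {F : Subfield ℂ} {m : ℕ}

theorem exists_atOne_eq_diagOne_map_subtype_mul_canonicalHaar [NeZero m]
    (hH : ∀ i j, canonicalHaar m i j ∈ F) {L R : LMat m} (h : IsBiorthogonalWaveletPair L R)
    {A : Matrix (Fin m) (Fin m) F} (hA : atOne L = A.map F.subtype) :
    ∃ G : Matrix.GeneralLinearGroup (Fin (m - 1)) F,
      atOne L = diagOne ((G : Matrix (Fin (m - 1)) (Fin (m - 1)) F).map F.subtype) *
        canonicalHaar m := by
  let HF : Matrix (Fin m) (Fin m) F := Matrix.of fun i j => ⟨canonicalHaar m j i, hH j i⟩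
  have hHF : HF.map F.subtype = (canonicalHaar m)ᴴ := by
    ext i j
    simp [HF, star_canonicalHaar]
  let G : Matrix (Fin (m - 1)) (Fin (m - 1)) F := lowerBlock ((m : F)⁻¹ • (A * HF))
  have hG : lowerBlock ((m : ℂ)⁻¹ • (atOne L * (canonicalHaar m)ᴴ)) = G.map F.subtype := by
    rw [hA, ← hHF, ← Matrix.map_mul]
    ext i j
    simp [G, lowerBlock]
  have hquadratic : atOne L * (atOne R)ᴴ = (m : ℂ) • 1 := by
    rw [← atOne_adj, ← map_mul, h.quadratic, ← const_natCast_smul_one, atOne_const]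
  obtain ⟨hdet, hL⟩ := isUnit_det_and_eq_diagOne_mul_canonicalHaar hquadratic
    ((rowSum_eq_ite_iff L).1 h.linear_left) ((rowSum_eq_ite_iff R).1 h.linear_right)
  rw [hG] at hdet hL
  have hdetG : G.det ≠ 0 := by
    rw [← RingHom.mapMatrix_apply, ← RingHom.map_det] at hdet
    exact ne_zero_of_map hdet.ne_zero
  exact ⟨Matrix.GeneralLinearGroup.mkOfDetNeZero G hdetG, hL⟩

theorem IsBiorthogonalWaveletPair.exists_det_eq_C_mul_X_pow (hm : m ≠ 0) {L R : LMat m}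
    (h : IsBiorthogonalWaveletPair L R) {k₀ : ℤ} {P : Matrix (Fin m) (Fin m) (Polynomial F)}
    (hL : L = zPow (-k₀) • (embed F).mapMatrix P) :
    ∃ (c : F) (d : ℕ), c ≠ 0 ∧ P.det = Polynomial.C c * Polynomial.X ^ d := by
  refine eq_C_mul_X_pow_of_isUnit_embed F ?_
  have hunit := (isUnit_of_mul_eq_natCast_smul_one hm h.quadratic).map Matrix.detMonoidHom
  rw [Matrix.coe_detMonoidHom, hL, Matrix.det_smul, ← RingHom.map_det] at hunit
  exact isUnit_of_mul_isUnit_right hunit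

theorem IsBiorthogonalWaveletPair.hasFactorization [NeZero m] {K : Subfield ℂ}
    (hF : ∀ x ∈ F, starRingEnd ℂ x ∈ F) (hH : ∀ i j, canonicalHaar m i j ∈ F)
    (hK : ∀ w : Fin m → ℂ, (∀ i, w i ∈ F) → w ≠ 0 →
      ∃ c : ℂ, IsUnitVector (c • w) ∧ ∀ i, (c • w) i ∈ K) {g : ℕ}
    {L : Matrix (Fin m) (Fin m) F[T;T⁻¹]} {R : LMat m} (hg : HasSize (toComplex F L) g)
    (h : IsBiorthogonalWaveletPair (toComplex F L) R) :
    HasFactorization F K g (toComplex F L) R := by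
  have hm : m ≠ 0 := NeZero.ne m
  obtain ⟨k₀, n, P, hgenus, hdeg, hLP⟩ := exists_eq_zPow_smul_embed
    (isUnit_of_mul_eq_natCast_smul_one hm h.quadratic).ne_zero
  obtain ⟨c, d, hc, hdet⟩ := h.exists_det_eq_C_mul_X_pow hm hLP
  have hone : atOne (toComplex F L) = (evalOne P).map F.subtype := by
    rw [hLP, atOne_zPow_smul, atOne_embed]
  obtain ⟨G, hG⟩ := exists_atOne_eq_diagOne_map_subtype_mul_canonicalHaar hH h hone
  choose! a u ha hu huK hau using
    fun (w : Fin m → F) (hw : w ≠ 0) => exists_rankOne_eq_vecMulVec_star hF hK hw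
  obtain ⟨w, r, N, k, hw, hr, hN, hk, hdegN, hP⟩ :=
    exists_polynomial_factorization ha hc hdet hdeg
  have hL : toComplex F L = zPow (-k₀) •
      ((List.ofFn fun s => primitiveParaunitary (u (w s))).prod *
        (List.ofFn fun i => leftFactor ((N i).map F.subtype) (k i)).reverse.prod *
        const (diagOne ((G : Matrix (Fin (m - 1)) (Fin (m - 1)) F).map F.subtype)) *
        const (canonicalHaar m)) := by
    simp only [primitiveParaunitary_eq_leftFactor, ← hau _ (hw _)]
    rw [mul_assoc _ (const _), ← const_mul, ← hG, hone, ← embed_mapMatrix_C,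
      ← embed_list_ofFn_prod_shiftFactor _ fun _ => 1, ← embed_list_ofFn_reverse_prod_shiftFactor,
      ← map_mul, ← map_mul, ← hP, hLP]
  refine ⟨k₀, d + m * k₀, d, r, fun s => u (w s), N, k, G, ?_, by ring, fun s => hu _ (hw s),
    fun s => huK _ (hw s), fun s i j => ?_, hr, hN, hk, ?_, hL, eq_of_mul_adj_eq hm h.quadratic ?_⟩
  · rw [hLP]
    exact isDetExponent_zPow_smul_embed hc hdet k₀
  · rw [← hau _ (hw s)]
    exact (Matrix.vecMulVec (a (w s)) (w s) i j).2
  · rw [← embed_list_ofFn_reverse_prod_shiftFactor]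
    exact (genus_embed_le hdegN).trans (hgenus.ge.trans hg)
  · rw [hL]
    exact zPow_smul_mul_const_canonicalHaar_mul_adj
      (isDual_factors (fun s => hu _ (hw s)) hN k G) _

end Necessity

end BiorthWavelet

end

open BiorthWavelet in
theorem theorem3p2_general (F K : Subfield ℂ) (hF : ∀ x ∈ F, (starRingEnd ℂ) x ∈ F)
    (m : ℕ) [NeZero m] (hH : ∀ i j, canonicalHaar m i j ∈ F)
    (hK : ∀ w : Fin m → ℂ, (∀ i, w i ∈ F) → w ≠ 0 →
      ∃ c : ℂ, IsUnitVector (c • w) ∧ ∀ i, (c • w) i ∈ K) (g : ℕ)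
    (L : Matrix (Fin m) (Fin m) (LaurentPolynomial F)) (R : LMat m)
    (hL : HasSize (toComplex F L) g) :
    IsBiorthogonalWaveletPair (toComplex F L) R ↔ HasFactorization F K g (toComplex F L) R :=
  ⟨fun h => h.hasFactorization hF hH hK hL, fun h => h.isBiorthogonalWaveletPair⟩

open BiorthWavelet in
theorem theorem3p2 (F : Subfield ℂ) (hF : ∀ x ∈ F, (starRingEnd ℂ) x ∈ F)
    (m : ℕ) (hm : 2 ≤ m) (hH : ∀ i j, canonicalHaar m i j ∈ F) (g : ℕ)
    (L R : Matrix (Fin m) (Fin m) (LaurentPolynomial F))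
    (hL : HasSize (toComplex F L) g) (hR : HasSize (toComplex F R) g) :
    (IsBiorthogonalWaveletPair (toComplex F L) (toComplex F R) ↔
      HasFactorization F ⊤ g (toComplex F L) (toComplex F R)) ∧
    ((∀ w : Fin m → ℂ, (∀ i, w i ∈ F) → w ≠ 0 → ∃ c ∈ F, IsUnitVector (c • w)) →
      (IsBiorthogonalWaveletPair (toComplex F L) (toComplex F R) ↔
        HasFactorization F F g (toComplex F L) (toComplex F R))) := by
  have : NeZero m := ⟨by omega⟩
  refine ⟨theorem3p2_general F ⊤ hF m hH (fun w _ hw => ?_) g L _ hL,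
    fun hunit => theorem3p2_general F F hF m hH (fun w hwF hw => ?_) g L _ hL⟩
  · obtain ⟨c, hc⟩ := exists_smul_isUnitVector hw
    exact ⟨c, hc, fun i => Subfield.mem_top _⟩
  · obtain ⟨c, hcF, hc⟩ := hunit w hwF hw
    exact ⟨c, hc, fun i => F.mul_mem hcF (hwF i)⟩
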